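/- Let $n\in\mathbb N$. A \emph{state} on a unital $*$-algebra over $\mathbb C$ is a positive unital linear functional on it, and $S(C)$ denotes the set of states of $C$; $E_{ij}$ are the matrix units of $M_n(\mathbb C)$. Let $\Lambda:S(M_n(\mathbb C)\otimes M_n(\mathbb C))\to S(M_n(\mathbb C)\otimes M_n(\mathbb C))$ be a map. Say that $\Lambda$ is a \emph{unitary induced channel in the quantum tensor model}, $\Lambda\in\mathcal L_{qa}(n)$, if there are Hilbert spaces $H_A,H_B$, a state $\phi\in S(B(H_A\otimes H_B))$ and unitaries $U=(u_{ij})\in M_n(B(H_A))$, $V=(v_{kl})\in M_n(B(H_B))$ such that, in $A'\otimes B(H_A\otimes H_B)\otimes B'$ with $A'=B'=M_n(\mathbb C)$, $$\Lambda(\varphi)(g\otimes h)=(\varphi\otimes\phi)\big((U\otimes 1_{BB'})(1_{A'A}\otimes V)(g\otimes 1_{AB}\otimes h)(1_{A'A}\otimes V^*)(U^*\otimes 1_{BB'})\big)$$ for all $\varphi\in S(M_n(\mathbb C)\otimes M_n(\mathbb C))$ and $g,h\in M_n(\mathbb C)$. Here $\varphi\otimes\phi$ is the functional $g\otimes T\otimes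 h\mapsto\varphi(g\otimes h)\phi(T)$. Let $\mathcal U(n)$ (the Brown algebra) be the universal unital C*-algebra generated by elements $u_{ij}$, $1\le i,j\le n$, subject to the relations $\sum_k u_{ik}u_{lk}^*=\delta_{il}1$ and $\sum_i u_{ik}^*u_{il}=\delta_{kl}1$, and let $\otimes_{\min}$ be the minimal (spatial) tensor product of C*-algebras. \textbf{Theorem.} The following conditions are equivalent. \begin{enumerate} \item $\Lambda\in\mathcal L_{qa}(n)$. \item There are unital C*-algebras $A,B$, a state $\tilde\phi\in S(A\otimes_{\min}B)$ and unitaries $(\tilde u_{ij})\in M_n(A)$, $(\tilde v_{kl})\in M_n(B)$ such that for every $\varphi\in S(M_n(\mathbb C)\otimes M_n(\mathbb C))$ and all $g,h\in M_n(\mathbb C)$ $$\Lambda(\varphi)(g\otimes h)=\sum_{i,j,k,l,p,r,s,t}\varphi(E_{ij}gE_{kl}\otimes E_{pr}hE_{st})\,\tilde\phi(\tilde u_{ij}\tilde u_{lk}^*\otimes\tilde v_{pr}\tilde v_{ts}^*).$$ \item There is a state $\phi\in S(\mathcal U(n)\otimes_{\min}\mathcal U(n))$ such that for every $\varphi\in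 S(M_n(\mathbb C)\otimes M_n(\mathbb C))$ and all $g,h\in M_n(\mathbb C)$ $$\Lambda(\varphi)(g\otimes h)=\sum_{i,j,k,l,p,r,s,t}\varphi(E_{ij}gE_{kl}\otimes E_{pr}hE_{st})\,\phi(u_{ij}u_{lk}^*\otimes v_{pr}v_{ts}^*),$$ where $(u_{ij})$ and $(v_{kl})$ are the canonical generators of the two copies of $\mathcal U(n)$. \end{enumerate} -/

import Mathlib

open scoped TensorProduct ComplexOrder ENNReal

noncomputable section

namespace UnitaryInduced

/-! ### States -/

/-- A state on a unital `*`-algebra over `ℂ` (in particular on a unital C*-algebra): a positive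
unital linear functional. -/
structure State (R : Type*) [Ring R] [Star R] [Algebra ℂ R] extends R →ₗ[ℂ] ℂ where
  map_one' : toFun 1 = 1
  nonneg' : ∀ a : R, 0 ≤ toFun (star a * a)

instance {R : Type*} [Ring R] [Star R] [Algebra ℂ R] : CoeFun (State R) (fun _ => R → ℂ) :=
  ⟨fun φ => φ.toLinearMap⟩

/-! ### Tensor products of Hilbert spaces and of operators -/

section Hilbert

variable (H K : Type*) [NormedAddCommGroup H] [InnerProductSpace ℂ H]
  [NormedAddCommGroup K] [InnerProductSpace ℂ K]

/-- The Hilbert space tensor product `H ⊗ K`: the completion of the algebraic tensor product. -/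
def HilbertTensor : Type _ := UniformSpace.Completion (H ⊗[ℂ] K)

instance : NormedAddCommGroup (HilbertTensor H K) :=
  inferInstanceAs (NormedAddCommGroup (UniformSpace.Completion (H ⊗[ℂ] K)))

instance : InnerProductSpace ℂ (HilbertTensor H K) :=
  inferInstanceAs (InnerProductSpace ℂ (UniformSpace.Completion (H ⊗[ℂ] K)))

instance : CompleteSpace (HilbertTensor H K) :=
  inferInstanceAs (CompleteSpace (UniformSpace.Completion (H ⊗[ℂ] K)))

variable {H K}

/-- The canonical isometric embedding of the algebraic tensor product, with dense range. -/
def toHilbertTensor : H ⊗[ℂ] K →ₗᵢ[ℂ] HilbertTensor H K :=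
  UniformSpace.Completion.toComplₗᵢ (E := H ⊗[ℂ] K)

/-- The bounded operator `S ⊗ T` on the Hilbert space tensor product `H ⊗ K`. -/
def tensorOp (S : H →L[ℂ] H) (T : K →L[ℂ] K) : HilbertTensor H K →L[ℂ] HilbertTensor H K :=
  (TensorProduct.mapL S T).completion

lemma tensorOp_toHilbertTensor (S : H →L[ℂ] H) (T : K →L[ℂ] K) (x : H) (y : K) :
    tensorOp S T (toHilbertTensor (x ⊗ₜ y)) = toHilbertTensor (S x ⊗ₜ T y) :=
  (TensorProduct.mapL S T).completion_apply_coe (x ⊗ₜ y)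

end Hilbert

/-! ### The universal representation of a C*-algebra -/

section Universal

variable {A : Type*} [CStarAlgebra A]

attribute [local instance] CStarAlgebra.spectralOrder CStarAlgebra.spectralOrderedRing

/-- A state, as a positive linear functional for the usual order of the C*-algebra. -/
def State.toPositive (φ : State A) : A →ₚ[ℂ] ℂ :=
  PositiveLinearMap.mk₀ φ.toLinearMap fun x hx => by
    obtain ⟨b, rfl⟩ := CStarAlgebra.nonneg_iff_eq_star_mul_self.mp hx
    exact φ.nonneg' b

/-- The GNS Hilbert space of a state. -/
abbrev State.GNSSpace (φ : State A) : Type _ := φ.toPositive.GNS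

/-- The GNS representation of a state. -/
def State.gnsRep (φ : State A) : A →⋆ₐ[ℂ] (φ.GNSSpace →L[ℂ] φ.GNSSpace) :=
  φ.toPositive.gnsStarAlgHom

variable (A) in
/-- The Hilbert space of the universal representation: the Hilbert space direct sum of the GNS
spaces of all states. -/
abbrev UniversalSpace : Type _ := lp (fun φ : State A => φ.GNSSpace) 2

/-- The action of `a` in the universal representation: the direct sum of its actions in the GNS
representations of all states. -/
def universalOp (a : A) : UniversalSpace A →L[ℂ] UniversalSpace A :=
  lp.mapCLM 2 (fun φ : State A => φ.gnsRep a) (norm_nonneg a)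
    fun φ => NonUnitalStarAlgHom.norm_apply_le φ.gnsRep a

lemma universalOp_apply (a : A) (x : UniversalSpace A) (φ : State A) :
    (universalOp a x) φ = φ.gnsRep a (x φ) := rfl

variable (A) in
/-- The universal representation of a unital C*-algebra (it is faithful). -/
def universalRep : A →⋆ₐ[ℂ] (UniversalSpace A →L[ℂ] UniversalSpace A) where
  toFun := universalOp
  map_one' := by ext x φ; simp [universalOp_apply]
  map_mul' a b := by ext x φ; simp [universalOp_apply]
  map_zero' := by ext x φ; simp [universalOp_apply]
  map_add' a b := by ext x φ; simp [universalOp_apply]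
  commutes' r := by
    ext x φ
    simp [universalOp_apply, Algebra.algebraMap_eq_smul_one]
  map_star' a := by
    rw [ContinuousLinearMap.star_eq_adjoint, ContinuousLinearMap.eq_adjoint_iff]
    intro x y
    simp only [lp.inner_eq_tsum, universalOp_apply]
    refine tsum_congr fun φ => ?_
    rw [map_star, ContinuousLinearMap.star_eq_adjoint, ContinuousLinearMap.adjoint_inner_left]

end Universal

/-! ### The minimal tensor product of C*-algebras -/

section Min

variable (A B : Type*) [CStarAlgebra A] [CStarAlgebra B]

/-- The minimal (spatial) tensor product `A ⊗_min B` of unital C*-algebras: the C*-algebra of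
operators on `H_A ⊗ H_B` generated by the operators `π_A a ⊗ π_B b`, where `π_A`, `π_B` are the
universal representations of `A` and `B` on `H_A`, `H_B`. -/
def MinTensor : StarSubalgebra ℂ (HilbertTensor (UniversalSpace A) (UniversalSpace B) →L[ℂ]
    HilbertTensor (UniversalSpace A) (UniversalSpace B)) :=
  (StarAlgebra.adjoin ℂ (Set.range fun p : A × B =>
    tensorOp (universalRep A p.1) (universalRep B p.2))).topologicalClosure

variable {A B}

/-- The elementary tensor `a ⊗ b` in `A ⊗_min B`. -/
def minTmul (a : A) (b : B) : MinTensor A B :=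
  ⟨tensorOp (universalRep A a) (universalRep B b),
    StarSubalgebra.le_topologicalClosure _ (StarAlgebra.subset_adjoin ℂ _ ⟨(a, b), rfl⟩)⟩

end Min

/-! ### C*-seminorms on `*`-algebras and the associated C*-algebras -/

/-- A C*-seminorm on a unital `*`-algebra over `ℂ`. -/
structure CStarSeminorm (R : Type*) [Ring R] [StarRing R] [Algebra ℂ R] extends
    Seminorm ℂ R where
  mul_le' : ∀ x y, toFun (x * y) ≤ toFun x * toFun y
  star_mul_self' : ∀ x, toFun (star x * x) = toFun x * toFun x

namespace CStarSeminorm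

variable {R : Type*} [Ring R] [StarRing R] [Algebra ℂ R]

lemma map_star (p : CStarSeminorm R) (x : R) :
    p.toSeminorm (star x) = p.toSeminorm x := by
  have key : ∀ y : R, p.toSeminorm y ≤ p.toSeminorm (star y) := by
    intro y
    rcases (apply_nonneg p.toSeminorm y).eq_or_lt with h | h
    · rw [← h]; exact apply_nonneg _ _
    · have h1 : p.toSeminorm y * p.toSeminorm y ≤ p.toSeminorm (star y) * p.toSeminorm y :=
        (p.star_mul_self' y).symm.le.trans (p.mul_le' _ _)
      exact le_of_mul_le_mul_right h1 h
  refine le_antisymm ?_ (key x)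
  simpa using key (star x)

/-- The `*`-algebra `R` equipped with the seminorm `p`. -/
@[nolint unusedArguments]
def Pre (_p : CStarSeminorm R) : Type _ := R

variable (p : CStarSeminorm R)

/-- The identity map `R → p.Pre`. -/
def toPre (x : R) : p.Pre := x

instance : SeminormedRing p.Pre :=
  RingSeminorm.toSeminormedRing (R := R)
    { toFun := p.toSeminorm
      map_zero' := map_zero _
      add_le' := map_add_le_add _
      neg' := map_neg_eq_map _
      mul_le' := p.mul_le' }

instance : StarRing p.Pre := inferInstanceAs (StarRing R)

lemma norm_toPre (x : R) : ‖p.toPre x‖ = p.toSeminorm x := rfl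

instance : NormedAlgebra ℂ p.Pre where
  __ := (inferInstanceAs (Algebra ℂ R) : Algebra ℂ p.Pre)
  norm_smul_le c x := (map_smul_eq_mul p.toSeminorm c x).le

instance [StarModule ℂ R] : StarModule ℂ p.Pre := inferInstanceAs (StarModule ℂ R)

/-- The Hausdorff completion of `R` with respect to the C*-seminorm `p`. -/
def Completion : Type _ := UniformSpace.Completion p.Pre

/-- The canonical map from `R` to its completion. -/
def toCompletion (x : R) : p.Completion := ((p.toPre x : p.Pre) : UniformSpace.Completion p.Pre)

instance : NormedRing p.Completion := inferInstanceAs (NormedRing (UniformSpace.Completion p.Pre))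

instance : CompleteSpace p.Completion :=
  inferInstanceAs (CompleteSpace (UniformSpace.Completion p.Pre))

instance : NormedAlgebra ℂ p.Completion where
  __ := (inferInstanceAs (Algebra ℂ (UniformSpace.Completion p.Pre)) : Algebra ℂ p.Completion)
  norm_smul_le := norm_smul_le (β := UniformSpace.Completion p.Pre)

lemma norm_toCompletion (x : R) : ‖p.toCompletion x‖ = p.toSeminorm x :=
  UniformSpace.Completion.norm_coe (p.toPre x)

instance : NormedStarGroup p.Pre where
  norm_star_le x := (p.map_star x).le

/-- The adjoint operation on the completion, extending the one on `R` by continuity. -/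
instance : Star p.Completion := ⟨UniformSpace.Completion.map (star : p.Pre → p.Pre)⟩

lemma continuous_star : Continuous (star : p.Completion → p.Completion) :=
  UniformSpace.Completion.continuous_map

lemma star_toCompletion (x : R) : star (p.toCompletion x) = p.toCompletion (star x) :=
  UniformSpace.Completion.map_coe (star_isometry (E := p.Pre)).uniformContinuous (p.toPre x)

lemma toCompletion_add (x y : R) :
    p.toCompletion (x + y) = p.toCompletion x + p.toCompletion y :=
  UniformSpace.Completion.coe_add (p.toPre x) (p.toPre y)

lemma toCompletion_mul (x y : R) :
    p.toCompletion (x * y) = p.toCompletion x * p.toCompletion y :=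
  UniformSpace.Completion.coe_mul (p.toPre x) (p.toPre y)

lemma toCompletion_one : p.toCompletion 1 = 1 := rfl

lemma toCompletion_smul (c : ℂ) (x : R) :
    p.toCompletion (c • x) = c • p.toCompletion x :=
  UniformSpace.Completion.coe_smul c (p.toPre x)

lemma completion_induction {P : p.Completion → Prop} (x : p.Completion)
    (hP : IsClosed {x | P x}) (h : ∀ x : R, P (p.toCompletion x)) : P x :=
  UniformSpace.Completion.induction_on x hP h

instance : StarRing p.Completion where
  star_involutive x := by
    have := p.continuous_star
    refine p.completion_induction (P := fun x => star (star x) = x) x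
      (isClosed_eq (by fun_prop) (by fun_prop)) fun x => ?_
    simp only [star_toCompletion, star_star]
  star_mul x y := by
    have := p.continuous_star
    refine p.completion_induction (P := fun x => star (x * y) = star y * star x) x
      (isClosed_eq (by fun_prop) (by fun_prop)) fun x => ?_
    refine p.completion_induction (P := fun y => star (p.toCompletion x * y) = star y * star (p.toCompletion x)) y
      (isClosed_eq (by fun_prop) (by fun_prop)) fun y => ?_
    simp only [star_toCompletion, ← toCompletion_mul, star_mul]
  star_add x y := by
    have := p.continuous_star
    refine p.completion_induction (P := fun x => star (x + y) = star x + star y) x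
      (isClosed_eq (by fun_prop) (by fun_prop)) fun x => ?_
    refine p.completion_induction (P := fun y => star (p.toCompletion x + y) = star (p.toCompletion x) + star y) y
      (isClosed_eq (by fun_prop) (by fun_prop)) fun y => ?_
    simp only [star_toCompletion, ← toCompletion_add, star_add]

instance : ContinuousStar p.Completion := ⟨p.continuous_star⟩

lemma norm_mul_self_le (x : p.Completion) : ‖x‖ * ‖x‖ ≤ ‖star x * x‖ := by
  refine p.completion_induction (P := fun x => ‖x‖ * ‖x‖ ≤ ‖star x * x‖) x
    (isClosed_le (continuous_norm.mul continuous_norm)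
      ((p.continuous_star.mul continuous_id).norm)) fun x => ?_
  rw [star_toCompletion, ← toCompletion_mul, norm_toCompletion, norm_toCompletion]
  exact (p.star_mul_self' x).symm.le

lemma star_smul_completion [StarModule ℂ R] (c : ℂ) (x : p.Completion) :
    star (c • x) = star c • star x := by
  refine p.completion_induction (P := fun x => star (c • x) = star c • star x) x
    (isClosed_eq (p.continuous_star.comp (continuous_const_smul c))
      (p.continuous_star.const_smul (star c))) fun x => ?_
  rw [← toCompletion_smul, star_toCompletion, star_toCompletion, ← toCompletion_smul, star_smul]

/-- The Hausdorff completion of a `*`-algebra with respect to a C*-seminorm is a C*-algebra. -/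
instance [StarModule ℂ R] : CStarAlgebra p.Completion where
  norm_mul_self_le := p.norm_mul_self_le
  star_smul := p.star_smul_completion

/-- The pointwise supremum of a pointwise bounded family of C*-seminorms. -/
def supr {ι : Type*} (q : ι → CStarSeminorm R)
    (hq : ∀ x, BddAbove (Set.range fun i => (q i).toSeminorm x)) : CStarSeminorm R where
  toSeminorm := Seminorm.of (fun x => ⨆ i, (q i).toSeminorm x)
    (fun x y => Real.iSup_le
      (fun i => (map_add_le_add _ x y).trans (add_le_add (le_ciSup (hq x) i) (le_ciSup (hq y) i)))
      (add_nonneg (Real.iSup_nonneg fun i => apply_nonneg _ _)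
        (Real.iSup_nonneg fun i => apply_nonneg _ _)))
    (fun c x => by
      simp only [map_smul_eq_mul]
      exact (Real.mul_iSup_of_nonneg (norm_nonneg c) _).symm)
  mul_le' x y := Real.iSup_le
      (fun i => ((q i).mul_le' x y).trans (mul_le_mul (le_ciSup (hq x) i) (le_ciSup (hq y) i)
        (apply_nonneg (q i).toSeminorm y) (Real.iSup_nonneg fun i => apply_nonneg _ _)))
      (mul_nonneg (Real.iSup_nonneg fun i => apply_nonneg _ _)
        (Real.iSup_nonneg fun i => apply_nonneg _ _))
  star_mul_self' x := by
    have h0 : ∀ z, 0 ≤ ⨆ i, (q i).toSeminorm z := fun z =>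
      Real.iSup_nonneg fun i => apply_nonneg _ _
    have hs : ∀ i, (q i).toSeminorm (star x * x) =
        (q i).toSeminorm x * (q i).toSeminorm x := fun i => (q i).star_mul_self' x
    apply le_antisymm
    · refine Real.iSup_le (fun i => ?_) (mul_nonneg (h0 x) (h0 x))
      rw [hs]
      exact mul_self_le_mul_self (apply_nonneg _ _) (le_ciSup (hq x) i)
    · have : (⨆ i, (q i).toSeminorm x) ≤ √(⨆ i, (q i).toSeminorm (star x * x)) := by
        refine Real.iSup_le (fun i => Real.le_sqrt_of_sq_le ?_) (Real.sqrt_nonneg _)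
        rw [sq, ← hs]
        exact le_ciSup (hq (star x * x)) i
      exact (mul_self_le_mul_self (h0 x) this).trans (Real.mul_self_sqrt (h0 _)).le

end CStarSeminorm

/-! ### The free `*`-algebra -/

section Free

variable (X : Type*)

/-- The free unital `*`-algebra over `ℂ` on the set `X`: the algebra of noncommutative polynomials
in the letters `(x, false)`, standing for `x`, and `(x, true)`, standing for `x*`. -/
def FreeStarAlgebra : Type _ := MonoidAlgebra ℂ (FreeMonoid (X × Bool))

instance : Ring (FreeStarAlgebra X) :=
  inferInstanceAs (Ring (MonoidAlgebra ℂ (FreeMonoid (X × Bool))))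

instance : Algebra ℂ (FreeStarAlgebra X) :=
  inferInstanceAs (Algebra ℂ (MonoidAlgebra ℂ (FreeMonoid (X × Bool))))

variable {X}

/-- The adjoint of a word: reverse it and exchange `x` and `x*`. -/
def adjointWord (w : FreeMonoid (X × Bool)) : FreeMonoid (X × Bool) :=
  star (FreeMonoid.map (fun p : X × Bool => (p.1, !p.2)) w)

lemma adjointWord_adjointWord (w : FreeMonoid (X × Bool)) : adjointWord (adjointWord w) = w := by
  have h : ∀ v : FreeMonoid (X × Bool), FreeMonoid.map (fun p : X × Bool => (p.1, !p.2)) (star v) =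
      star (FreeMonoid.map (fun p : X × Bool => (p.1, !p.2)) v) := fun v => List.map_reverse
  rw [adjointWord, adjointWord, h, star_star, FreeMonoid.map_map]
  have h2 : (fun p : X × Bool => (p.1, !p.2)) ∘ (fun p : X × Bool => (p.1, !p.2)) = id := by
    funext p
    simp
  rw [h2, FreeMonoid.map_id, MonoidHom.id_apply]

lemma adjointWord_mul (v w : FreeMonoid (X × Bool)) :
    adjointWord (v * w) = adjointWord w * adjointWord v := by
  rw [adjointWord, map_mul, star_mul]; rfl

namespace FreeStarAlgebra

/-- The monomial `c • w` for a word `w`. -/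
def monomial (w : FreeMonoid (X × Bool)) (c : ℂ) : FreeStarAlgebra X :=
  MonoidAlgebra.single w c

/-- The generator `x` of the free `*`-algebra. -/
def gen (x : X) : FreeStarAlgebra X := monomial (FreeMonoid.of (x, false)) 1

/-- The conjugate-linear extension of `adjointWord`. -/
instance : Star (FreeStarAlgebra X) where
  star f := MonoidAlgebra.map (starRingEnd ℂ).toAddMonoidHom
    (MonoidAlgebra.mapDomain adjointWord f)

lemma star_monomial (w : FreeMonoid (X × Bool)) (c : ℂ) :
    star (monomial w c) = monomial (adjointWord w) (star c) := by
  refine (congrArg (MonoidAlgebra.map _) MonoidAlgebra.mapDomain_single).trans ?_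
  exact MonoidAlgebra.map_single _ _ _

lemma star_zero' : star (0 : FreeStarAlgebra X) = 0 := by
  refine (congrArg (MonoidAlgebra.map _) (MonoidAlgebra.mapDomain_zero _)).trans ?_
  exact MonoidAlgebra.map_zero _

lemma star_add' (f g : FreeStarAlgebra X) : star (f + g) = star f + star g := by
  refine (congrArg (MonoidAlgebra.map _) (MonoidAlgebra.mapDomain_add _ _ _)).trans ?_
  exact MonoidAlgebra.map_add _ _ _

lemma monomial_mul (v w : FreeMonoid (X × Bool)) (c d : ℂ) :
    monomial v c * monomial w d = monomial (v * w) (c * d) :=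
  MonoidAlgebra.single_mul_single _ _ _ _

lemma smul_monomial (w : FreeMonoid (X × Bool)) (c d : ℂ) :
    c • monomial w d = monomial w (c * d) :=
  MonoidAlgebra.smul_single _ _ _

lemma one_eq : (1 : FreeStarAlgebra X) = monomial 1 1 := rfl

lemma induction {P : FreeStarAlgebra X → Prop} (f : FreeStarAlgebra X) (zero : P 0)
    (add : ∀ f g, P f → P g → P (f + g)) (mono : ∀ w c, P (monomial w c)) : P f :=
  MonoidAlgebra.induction_linear (motive := P) f zero add mono

instance : StarRing (FreeStarAlgebra X) where
  star_involutive f := by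
    refine induction (P := fun f => star (star f) = f) f ?_ (fun f g hf hg => ?_) fun w c => ?_
    · rw [star_zero', star_zero']
    · rw [star_add', star_add', hf, hg]
    · rw [star_monomial, star_monomial, adjointWord_adjointWord, star_star]
  star_mul f g := by
    refine induction (P := fun f => star (f * g) = star g * star f) f ?_
      (fun f h hf hh => ?_) fun v c => ?_
    · rw [zero_mul, star_zero', mul_zero]
    · rw [add_mul, star_add', star_add', mul_add, hf, hh]
    refine induction (P := fun g => star (monomial v c * g) = star g * star (monomial v c)) g ?_
      (fun f h hf hh => ?_) fun w d => ?_
    · rw [mul_zero, star_zero', zero_mul]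
    · rw [mul_add, star_add', star_add', add_mul, hf, hh]
    · rw [monomial_mul, star_monomial, star_monomial, star_monomial, monomial_mul,
        adjointWord_mul, star_mul]
  star_add := star_add'

instance : StarModule ℂ (FreeStarAlgebra X) where
  star_smul c f := by
    refine induction (P := fun f => star (c • f) = star c • star f) f ?_
      (fun f h hf hh => ?_) fun w d => ?_
    · rw [smul_zero, star_zero', smul_zero]
    · rw [smul_add, star_add', star_add', smul_add, hf, hh]
    · rw [smul_monomial, star_monomial, star_monomial, smul_monomial, star_mul']

end FreeStarAlgebra

end Free

/-! ### The Brown algebra -/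

section Brown

variable (n : ℕ)

/-- The C*-seminorms on the free `*`-algebra on letters `u_{ij}` that annihilate the relations
`∑_k u_{ik} u_{lk}^* = δ_{il} 1` and `∑_i u_{ik}^* u_{il} = δ_{kl} 1`, saying that the matrix
`(u_{ij})` is unitary. -/
structure BrownSeminorm extends CStarSeminorm (FreeStarAlgebra (Fin n × Fin n)) where
  rel_mul_star : ∀ i l : Fin n, toFun (∑ k, FreeStarAlgebra.gen (i, k) *
    star (FreeStarAlgebra.gen (l, k)) - if i = l then 1 else 0) = 0
  rel_star_mul : ∀ k l : Fin n, toFun (∑ i, star (FreeStarAlgebra.gen (i, k)) *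
    FreeStarAlgebra.gen (i, l) - if k = l then 1 else 0) = 0

variable {n}

lemma norm_le_one_of_sum_eq_one {C ι : Type*} [CStarAlgebra C] [Fintype ι] (a : ι → C)
    (h : ∑ i, a i * star (a i) = 1) (i : ι) : ‖a i‖ ≤ 1 := by
  let _ := CStarAlgebra.spectralOrder C
  have := CStarAlgebra.spectralOrderedRing C
  have h1 : a i * star (a i) ≤ 1 := by
    rw [← h]
    exact Finset.single_le_sum (f := fun i => a i * star (a i))
      (fun j _ => mul_star_self_nonneg _) (Finset.mem_univ i)
  have h2 := CStarAlgebra.norm_le_norm_of_nonneg_of_le (mul_star_self_nonneg (a i)) h1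
  rw [CStarRing.norm_self_mul_star] at h2
  have h3 : ‖(1 : C)‖ ≤ 1 := by
    rcases subsingleton_or_nontrivial C with hC | hC
    · simp [Subsingleton.elim (1 : C) 0]
    · simp
  nlinarith [norm_nonneg (a i)]

namespace BrownSeminorm

open FreeStarAlgebra

variable (p : BrownSeminorm n)

lemma gen_le (i k : Fin n) : p.toSeminorm (gen (i, k)) ≤ 1 := by
  let q := p.toCStarSeminorm
  have h : ∑ k, q.toCompletion (gen (i, k)) * star (q.toCompletion (gen (i, k))) = 1 := by
    have h0 := p.rel_mul_star i i
    rw [if_pos rfl] at h0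
    let T : FreeStarAlgebra (Fin n × Fin n) →+ q.Completion :=
      AddMonoidHom.mk' q.toCompletion q.toCompletion_add
    have h1 : T (∑ k, gen (i, k) * star (gen (i, k)) - 1) = 0 :=
      norm_eq_zero.mp ((q.norm_toCompletion _).trans h0)
    rw [map_sub, map_sum, sub_eq_zero] at h1
    refine Eq.trans (Finset.sum_congr rfl fun k _ => ?_) h1
    rw [q.star_toCompletion, ← q.toCompletion_mul]
    rfl
  have := norm_le_one_of_sum_eq_one (C := q.Completion) _ h k
  rwa [q.norm_toCompletion] at this

lemma one_le : p.toSeminorm 1 ≤ 1 := by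
  have := p.star_mul_self' 1
  rw [star_one, mul_one] at this
  change p.toSeminorm 1 = p.toSeminorm 1 * p.toSeminorm 1 at this
  nlinarith [apply_nonneg p.toSeminorm (1 : FreeStarAlgebra (Fin n × Fin n))]

lemma word_le (w : FreeMonoid ((Fin n × Fin n) × Bool)) : p.toSeminorm (monomial w 1) ≤ 1 := by
  induction w using FreeMonoid.inductionOn' with
  | one => exact p.one_le
  | of_mul a w ih =>
    have h1 : p.toSeminorm (monomial (FreeMonoid.of a) 1) ≤ 1 := by
      obtain ⟨⟨i, k⟩, b⟩ := a
      cases b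
      · exact p.gen_le i k
      · have := p.toCStarSeminorm.map_star (gen (i, k))
        rw [gen, star_monomial, star_one] at this
        exact this.le.trans (p.gen_le i k)
    have h2 : monomial (FreeMonoid.of a * w) 1 = monomial (FreeMonoid.of a) 1 * monomial w 1 := by
      rw [monomial_mul, one_mul]
    rw [h2]
    exact (p.mul_le' _ _).trans (mul_le_one₀ h1 (apply_nonneg p.toSeminorm _) ih)

lemma bddAbove (x : FreeStarAlgebra (Fin n × Fin n)) :
    BddAbove (Set.range fun p : BrownSeminorm n => p.toCStarSeminorm.toSeminorm x) := by
  suffices h : ∃ C, ∀ p : BrownSeminorm n, p.toSeminorm x ≤ C by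
    obtain ⟨C, hC⟩ := h
    exact ⟨C, by rintro _ ⟨p, rfl⟩; exact hC p⟩
  refine FreeStarAlgebra.induction (P := fun x => ∃ C, ∀ p : BrownSeminorm n, p.toSeminorm x ≤ C)
    x ⟨0, fun p => (map_zero _).le⟩ ?_ fun w c => ⟨‖c‖, fun p => ?_⟩
  · rintro f g ⟨C, hC⟩ ⟨D, hD⟩
    exact ⟨C + D, fun p => (map_add_le_add _ _ _).trans (add_le_add (hC p) (hD p))⟩
  · have : monomial w c = c • monomial w 1 := by rw [smul_monomial, mul_one]
    rw [this, map_smul_eq_mul]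
    exact mul_le_of_le_one_right (norm_nonneg c) (p.word_le w)

end BrownSeminorm

variable (n) in
/-- The largest C*-seminorm on the free `*`-algebra on letters `u_{ij}` that annihilates the
relations making `(u_{ij})` a unitary matrix. -/
def brownUniversalSeminorm : CStarSeminorm (FreeStarAlgebra (Fin n × Fin n)) :=
  CStarSeminorm.supr (fun p : BrownSeminorm n => p.toCStarSeminorm) BrownSeminorm.bddAbove

variable (n) in
/-- The Brown algebra `𝒰(n)`: the universal unital C*-algebra generated by the entries `u_{ij}` of
a unitary `n × n` matrix. -/
def BrownAlgebra : Type := (brownUniversalSeminorm n).Completion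

instance : CStarAlgebra (BrownAlgebra n) :=
  inferInstanceAs (CStarAlgebra (brownUniversalSeminorm n).Completion)

/-- The matrix `(u_{ij})` of canonical generators of the Brown algebra. -/
def brownGen : Matrix (Fin n) (Fin n) (BrownAlgebra n) :=
  Matrix.of fun i j => (brownUniversalSeminorm n).toCompletion (FreeStarAlgebra.gen (i, j))

end Brown

/-! ### Unitary induced channels -/

section Channels

/-- The matrix algebra `M_n(ℂ)`. -/
abbrev Mat (n : ℕ) : Type := Matrix (Fin n) (Fin n) ℂ

/-- The matrix unit `E_{ij}`. -/
abbrev matUnit {n : ℕ} (i j : Fin n) : Mat n := Matrix.single i j 1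

variable {n : ℕ} {C : Type*} [Ring C] [Algebra ℂ C]

/-- The product functional `φ' ⊗ φ` on `A' ⊗ C ⊗ B'`, for functionals `φ'` on
`A' ⊗ B' = M_n(ℂ) ⊗ M_n(ℂ)` and `φ` on `C`: it sends `g ⊗ T ⊗ h` to `φ' (g ⊗ h) * φ T`. -/
def productFunctional (φ' : Mat n ⊗[ℂ] Mat n →ₗ[ℂ] ℂ) (φ : C →ₗ[ℂ] ℂ) :
    Mat n ⊗[ℂ] (C ⊗[ℂ] Mat n) →ₗ[ℂ] ℂ :=
  LinearMap.mul' ℂ ℂ ∘ₗ TensorProduct.map φ φ' ∘ₗ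
    (TensorProduct.leftComm ℂ (Mat n) C (Mat n)).toLinearMap

lemma productFunctional_tmul (φ' : Mat n ⊗[ℂ] Mat n →ₗ[ℂ] ℂ) (φ : C →ₗ[ℂ] ℂ) (g h : Mat n)
    (T : C) : productFunctional φ' φ (g ⊗ₜ (T ⊗ₜ h)) = φ' (g ⊗ₜ h) * φ T := by
  simp [productFunctional, mul_comm]

variable {HA HB : Type*} [NormedAddCommGroup HA] [InnerProductSpace ℂ HA]
  [NormedAddCommGroup HB] [InnerProductSpace ℂ HB]

/-- The element `U ⊗ 1_{BB'} = ∑ E_{ij} ⊗ (u_{ij} ⊗ 1) ⊗ 1` of `A' ⊗ B(H_A ⊗ H_B) ⊗ B'` given by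
a matrix `U = (u_{ij})` over `B(H_A)`. -/
def ampLeft (U : Matrix (Fin n) (Fin n) (HA →L[ℂ] HA)) :
    Mat n ⊗[ℂ] ((HilbertTensor HA HB →L[ℂ] HilbertTensor HA HB) ⊗[ℂ] Mat n) :=
  ∑ i, ∑ j, matUnit i j ⊗ₜ (tensorOp (U i j) 1 ⊗ₜ 1)

/-- The element `1_{A'A} ⊗ V = ∑ 1 ⊗ (1 ⊗ v_{kl}) ⊗ E_{kl}` of `A' ⊗ B(H_A ⊗ H_B) ⊗ B'` given by
a matrix `V = (v_{kl})` over `B(H_B)`. -/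
def ampRight (V : Matrix (Fin n) (Fin n) (HB →L[ℂ] HB)) :
    Mat n ⊗[ℂ] ((HilbertTensor HA HB →L[ℂ] HilbertTensor HA HB) ⊗[ℂ] Mat n) :=
  ∑ k, ∑ l, 1 ⊗ₜ (tensorOp 1 (V k l) ⊗ₜ matUnit k l)

universe u

/-- `Λ` is a unitary induced channel in the quantum tensor model. -/
def IsTensorUnitaryInduced (Λ : State (Mat n ⊗[ℂ] Mat n) → State (Mat n ⊗[ℂ] Mat n)) : Prop :=
  ∃ (HA HB : Type u) (_ : NormedAddCommGroup HA) (_ : InnerProductSpace ℂ HA)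
    (_ : CompleteSpace HA) (_ : NormedAddCommGroup HB) (_ : InnerProductSpace ℂ HB)
    (_ : CompleteSpace HB)
    (φ : State (HilbertTensor HA HB →L[ℂ] HilbertTensor HA HB))
    (U : Matrix (Fin n) (Fin n) (HA →L[ℂ] HA)) (V : Matrix (Fin n) (Fin n) (HB →L[ℂ] HB)),
    U ∈ unitary (Matrix (Fin n) (Fin n) (HA →L[ℂ] HA)) ∧
    V ∈ unitary (Matrix (Fin n) (Fin n) (HB →L[ℂ] HB)) ∧
    ∀ (ω : State (Mat n ⊗[ℂ] Mat n)) (g h : Mat n),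
      Λ ω (g ⊗ₜ h) = productFunctional ω.toLinearMap φ.toLinearMap
        (ampLeft U * ampRight V * (g ⊗ₜ (1 ⊗ₜ h)) * ampRight (star V) * ampLeft (star U))

/-- `Λ` is given by the channel formula for matrices `u`, `v` over C*-algebras `A`, `B` and a
state `φ` on `A ⊗_min B`. -/
def ChannelFormula {A B : Type*} [CStarAlgebra A] [CStarAlgebra B]
    (Λ : State (Mat n ⊗[ℂ] Mat n) → State (Mat n ⊗[ℂ] Mat n))
    (u : Matrix (Fin n) (Fin n) A) (v : Matrix (Fin n) (Fin n) B)
    (φ : State (MinTensor A B)) : Prop :=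
  ∀ (ω : State (Mat n ⊗[ℂ] Mat n)) (g h : Mat n),
    Λ ω (g ⊗ₜ h) = ∑ i, ∑ j, ∑ k, ∑ l, ∑ p, ∑ r, ∑ s, ∑ t,
      ω ((matUnit i j * g * matUnit k l) ⊗ₜ (matUnit p r * h * matUnit s t)) *
        φ (minTmul (u i j * star (u l k)) (v p r * star (v t s)))

end Channels

end UnitaryInduced

end

open UnitaryInduced

universe u v

/-! All three conditions express the same numbers: the channel depends only on the values of a
functional at `u_{ij} u_{lk}^* ⊗ v_{pr} v_{ts}^*`. For operators this is `productFunctional_conj`,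
which expands the conjugation by `U` and `V` in matrix units. It remains to move states between
tensor products without changing these values, and the Brown algebra is the hub. A unitary matrix
over a C*-algebra is a `*`-homomorphism out of it (`brownLift`), so states pull back to it.
Conversely, a faithful representation of the Brown algebra carries its generators to unitary
operator matrices, and states extend along it.

Both movements rest on one norm inequality, `norm_spatialRep_le`: on `A ⊗ B`, the norm given by
faithful representations dominates the norm given by any representations. One leg is changed at a
time. Compressing `∑ π(a_i) ⊗ T_i` to finitely many orthonormal vectors of the second space gives a
matrix over `A`, acting through the amplification of `π`; an amplification is always contractive,
and it is isometric when `π` is faithful.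

A functional dominated by a spatial norm then extends to a state by Hahn–Banach
(`exists_state_comp_eq`), because a contractive unital functional on a C*-algebra is positive.
Faithfulness of the universal representation, which makes all this apply to `MinTensor`, comes from
the same extension principle.

The Brown algebra lives in `Type`, so copying its universal space into other universes lets the
universes in the first two conditions be independent. -/

noncomputable section

namespace UnitaryInduced

/-! ### States as contractive unital functionals, and faithfulness of the universal representation.
-/

section States

attribute [local instance] CStarAlgebra.spectralOrder CStarAlgebra.spectralOrderedRing

variable {C : Type*} [CStarAlgebra C]

/-- A state on a C*-algebra is contractive. -/
lemma State.norm_apply_le (φ : State C) (x : C) : ‖φ x‖ ≤ ‖x‖ := by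
  have h1 : ‖φ.toPositive 1‖ = 1 := by
    have : φ.toPositive 1 = 1 := φ.map_one'
    rw [this, norm_one]
  -- In the GNS inner product `φ x = ⟪1, x⟫`. The class of `1` is a unit vector and that of `x` has
  -- squared norm `φ (star x * x)`, so Cauchy–Schwarz gives the bound.
  have key : ‖φ.toPositive.toPreGNS x‖ ^ 2 ≤ ‖x‖ ^ 2 := by
    have h := φ.toPositive.preGNS_norm_sq (φ.toPositive.toPreGNS x)
    have h2 := φ.toPositive.norm_apply_le_of_nonneg (star x * x) (star_mul_self_nonneg x)
    rw [h1, one_mul, CStarRing.norm_star_mul_self] at h2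
    rw [PositiveLinearMap.ofPreGNS_toPreGNS] at h
    rw [← h] at h2
    simpa [sq] using h2
  have key1 : ‖φ.toPositive.toPreGNS 1‖ ^ 2 = 1 := by
    have h := φ.toPositive.preGNS_norm_sq (φ.toPositive.toPreGNS 1)
    rw [PositiveLinearMap.ofPreGNS_toPreGNS, star_one, one_mul,
      show φ.toPositive 1 = 1 from φ.map_one'] at h
    exact_mod_cast h
  have h := norm_inner_le_norm (𝕜 := ℂ) (φ.toPositive.toPreGNS 1) (φ.toPositive.toPreGNS x)
  rw [PositiveLinearMap.preGNS_inner_def, PositiveLinearMap.ofPreGNS_toPreGNS,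
    PositiveLinearMap.ofPreGNS_toPreGNS, star_one, one_mul,
    (pow_eq_one_iff_of_nonneg (norm_nonneg _) two_ne_zero).mp key1,
    one_mul] at h
  exact h.trans (le_of_sq_le_sq key (norm_nonneg x))

/-- A contractive unital functional is nonnegative at positive elements. -/
lemma nonneg_of_contractive (F : C →ₗ[ℂ] ℂ) (hF : ∀ x, ‖F x‖ ≤ ‖x‖) (h1 : F 1 = 1)
    {y : C} (hy : 0 ≤ y) : 0 ≤ F y := by
  have hn1 : ‖(1 : C)‖ = 1 := by
    have : Nontrivial C := ⟨1, 0, fun h => by simp [h] at h1⟩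
    exact norm_one
  have hsa : star y = y := (IsSelfAdjoint.of_nonneg hy).star_eq
  rw [Complex.nonneg_iff]
  constructor
  -- Since `0 ≤ ‖y‖ - y ≤ ‖y‖`, the value `F y` lies in the disc of centre and radius `‖y‖`, hence
  -- in the right half-plane.
  · have h2 : ‖algebraMap ℝ C ‖y‖ - y‖ ≤ ‖algebraMap ℝ C ‖y‖‖ :=
      CStarAlgebra.norm_le_norm_of_nonneg_of_le
        (sub_nonneg.mpr (IsSelfAdjoint.of_nonneg hy).le_algebraMap_norm_self) (sub_le_self _ hy)
    have h3 : algebraMap ℝ C ‖y‖ = ((‖y‖ : ℝ) : ℂ) • (1 : C) := by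
      rw [Algebra.algebraMap_eq_smul_one, Complex.coe_smul]
    rw [h3] at h2
    have h4 := (hF _).trans h2
    rw [map_sub, map_smul, h1, norm_smul, hn1] at h4
    have h5 := (Complex.abs_re_le_norm _).trans h4
    simp only [smul_eq_mul, mul_one, Complex.sub_re, Complex.ofReal_re, Complex.norm_real,
      norm_norm] at h5
    linarith [le_abs_self (‖y‖ - (F y).re)]
  -- Test `F` on `y - i s`. The terms `s ^ 2` cancel, leaving a bound on `-2 * s * (F y).im` uniform
  -- in `s`, which forces the imaginary part to vanish.
  · have h2 : ∀ s : ℝ, (s - (F y).im) ^ 2 ≤ ‖y‖ ^ 2 + s ^ 2 := by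
      intro s
      have h3 : ‖y - ((s : ℂ) * Complex.I) • (1 : C)‖ ^ 2 ≤ ‖y‖ ^ 2 + s ^ 2 := by
        rw [sq, ← CStarRing.norm_star_mul_self]
        have : star (y - ((s : ℂ) * Complex.I) • (1 : C)) * (y - ((s : ℂ) * Complex.I) • (1 : C))
            = y * y + ((s : ℂ) ^ 2) • (1 : C) := by
          simp only [star_sub, hsa, star_smul, star_one, sub_mul, mul_sub, smul_mul_assoc,
            mul_smul_comm, one_mul, mul_one]
          have e : star ((s : ℂ) * Complex.I) = -((s : ℂ) * Complex.I) := by simp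
          have e2 : ((s : ℂ) * Complex.I) * -((s : ℂ) * Complex.I) = (s : ℂ) ^ 2 := by
            linear_combination (-(s : ℂ) ^ 2) * Complex.I_sq
          rw [e, smul_sub, smul_smul, e2, neg_smul]
          abel
        rw [this]
        refine (norm_add_le _ _).trans (add_le_add ((norm_mul_le _ _).trans (sq ‖y‖).ge) ?_)
        rw [norm_smul, hn1]
        simp
      have h4 := (hF (y - ((s : ℂ) * Complex.I) • (1 : C)))
      rw [map_sub, map_smul, h1] at h4
      have h5 := (Complex.abs_im_le_norm _).trans h4
      simp only [smul_eq_mul, mul_one, Complex.sub_im, Complex.mul_im, Complex.ofReal_re,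
        Complex.I_im, Complex.ofReal_im, Complex.I_re, mul_zero, add_zero] at h5
      calc (s - (F y).im) ^ 2 = |(F y).im - s| ^ 2 := by rw [sq_abs]; ring
        _ ≤ _ := pow_le_pow_left₀ (abs_nonneg _) h5 2
        _ ≤ _ := h3
    by_contra h0
    have h0 : (F y).im ≠ 0 := fun h => h0 h.symm
    -- Chosen so that `-2 * s * (F y).im = ‖y‖ ^ 2 + 1`, too large by one.
    have h3 := h2 (-(‖y‖ ^ 2 + 1) / (2 * (F y).im))
    have h4 : 2 * (-(‖y‖ ^ 2 + 1) / (2 * (F y).im)) * (F y).im = -(‖y‖ ^ 2 + 1) := by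
      field_simp
    nlinarith [sq_nonneg (F y).im]

/-- A contractive unital functional on a C*-algebra is a state. -/
def State.ofContractive (F : C →ₗ[ℂ] ℂ) (hF : ∀ x, ‖F x‖ ≤ ‖x‖) (h1 : F 1 = 1) : State C where
  toLinearMap := F
  map_one' := h1
  nonneg' a := nonneg_of_contractive F hF h1 (star_mul_self_nonneg a)

/-- Extension of functionals to states: a functional `f` dominated by the norm of a unital linear
map `Θ` into a C*-algebra factors through a state. -/
lemma exists_state_comp_eq {E : Type*} [AddCommGroup E] [Module ℂ E] (Θ : E →ₗ[ℂ] C)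
    (f : E →ₗ[ℂ] ℂ) (hf : ∀ x, ‖f x‖ ≤ ‖Θ x‖) {e : E} (hΘ : Θ e = 1) (he : f e = 1) :
    ∃ φ : State C, ∀ x, φ (Θ x) = f x := by
  -- Domination makes `f` vanish on the kernel of `Θ`, so `f` descends to the range and the choice
  -- of the section `s` is immaterial.
  obtain ⟨s, hs⟩ := Θ.rangeRestrict.exists_rightInverse_of_surjective Θ.range_rangeRestrict
  have hs' : ∀ y : LinearMap.range Θ, Θ (s y) = y := fun y =>
    congrArg Subtype.val (LinearMap.congr_fun hs y)
  let g : StrongDual ℂ (LinearMap.range Θ) := (f ∘ₗ s).mkContinuous 1 fun y => by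
    rw [one_mul, LinearMap.comp_apply]
    refine (hf _).trans ?_
    rw [hs']
    exact le_rfl
  have hg : ∀ x, g ⟨Θ x, x, rfl⟩ = f x := by
    intro x
    have : f (s ⟨Θ x, x, rfl⟩ - x) = 0 := by
      rw [← norm_le_zero_iff]
      refine (hf _).trans ?_
      rw [map_sub, hs', sub_self, norm_zero]
    rw [map_sub, sub_eq_zero] at this
    exact this
  -- Hahn–Banach preserves only the norm, but contractive and unital already imply positive. Hence
  -- the range of `Θ` may be a mere subspace containing `1`.
  obtain ⟨F, hF, hFn⟩ := exists_extension_norm_eq (LinearMap.range Θ) g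
  have hn : ‖F‖ ≤ 1 := hFn.trans_le (LinearMap.mkContinuous_norm_le _ zero_le_one _)
  have hFΘ : ∀ x, F (Θ x) = f x := fun x => (hF ⟨Θ x, x, rfl⟩).trans (hg x)
  exact ⟨State.ofContractive F.toLinearMap (fun x => by simpa using F.le_of_opNorm_le hn x)
    (by rw [← hΘ]; exact (hFΘ e).trans he), hFΘ⟩

/-- States separate the points of a C*-algebra. -/
lemma exists_state_star_mul_self_ne_zero {a : C} (ha : a ≠ 0) :
    ∃ φ : State C, φ (star a * a) ≠ 0 := by
  have : Nontrivial C := ⟨a, 0, ha⟩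
  have hspec : ((‖star a * a‖ : ℝ) : ℂ) ∈ spectrum ℂ (star a * a) := by
    have := CStarAlgebra.norm_mem_spectrum_of_nonneg (star_mul_self_nonneg a)
    exact (spectrum.algebraMap_mem_iff ℂ).mpr this
  -- On polynomials in `star a * a`, evaluate at the spectral point `‖star a * a‖`. By spectral
  -- mapping the value lies in the spectrum of the polynomial in `star a * a`, so the norm dominates
  -- it.
  obtain ⟨φ, hφ⟩ := exists_state_comp_eq (Polynomial.aeval (star a * a)).toLinearMap
    (Polynomial.leval ((‖star a * a‖ : ℝ) : ℂ)) (e := 1)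
    (fun p => spectrum.norm_le_norm_of_mem
      (spectrum.subset_polynomial_aeval (star a * a) p ⟨_, hspec, rfl⟩)) (by simp) (by simp)
  refine ⟨φ, ?_⟩
  have h := hφ Polynomial.X
  simp only [AlgHom.toLinearMap_apply, Polynomial.aeval_X, Polynomial.leval_apply,
    Polynomial.eval_X] at h
  rw [h, CStarRing.norm_star_mul_self]
  simpa using ha

/-- The universal representation is faithful. -/
lemma universalRep_injective : Function.Injective (universalRep C) := by
  classical
  rw [injective_iff_map_eq_zero]
  intro a h
  by_contra ha
  obtain ⟨φ, hφ⟩ := exists_state_star_mul_self_ne_zero ha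
  apply hφ
  -- Vectors supported in the summand of `φ` isolate its GNS representation.
  have h1 : φ.gnsRep a = 0 := by
    ext ξ
    have h2 : universalRep C a (lp.single 2 φ ξ) φ = 0 := by rw [h]; rfl
    have h3 : φ.gnsRep a ((lp.single 2 φ ξ : UniversalSpace C) φ) = 0 := h2
    rwa [lp.single_apply_self] at h3
  -- The cyclic vector goes to the class of `a`, whose squared norm is `φ (star a * a)`.
  have h2 : φ.gnsRep a (φ.toPositive.toPreGNS 1) = 0 := by rw [h1]; rfl
  have h3 : ((φ.toPositive.toPreGNS a : φ.toPositive.PreGNS) : φ.GNSSpace) = 0 := by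
    rw [← h2]
    refine Eq.trans ?_ (φ.toPositive.gnsNonUnitalStarAlgHom_apply_coe (a := a)).symm
    simp
  have h4 : ‖φ.toPositive.toPreGNS a‖ = 0 := by
    rw [← UniformSpace.Completion.norm_coe, h3, norm_zero]
  have h5 := φ.toPositive.preGNS_norm_sq (φ.toPositive.toPreGNS a)
  rw [h4, PositiveLinearMap.ofPreGNS_toPreGNS] at h5
  exact h5.symm.trans (by simp)

end States

/-! ### Operators on Hilbert space tensor products, and the flip. -/

section TensorOperators

variable {H K : Type*} [NormedAddCommGroup H] [InnerProductSpace ℂ H]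
  [NormedAddCommGroup K] [InnerProductSpace ℂ K]

lemma denseRange_toHilbertTensor :
    DenseRange (toHilbertTensor : H ⊗[ℂ] K →ₗᵢ[ℂ] HilbertTensor H K) :=
  UniformSpace.Completion.denseRange_coe

/-- Bounded operators on `H ⊗ K` agree if they agree on elementary tensors. -/
lemma hilbertTensor_ext {L : Type*} [NormedAddCommGroup L] [NormedSpace ℂ L]
    {S T : HilbertTensor H K →L[ℂ] L}
    (h : ∀ (x : H) (y : K), S (toHilbertTensor (x ⊗ₜ y)) = T (toHilbertTensor (x ⊗ₜ y))) :
    S = T := by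
  refine ContinuousLinearMap.coeFn_injective
    (denseRange_toHilbertTensor.equalizer S.continuous T.continuous (funext fun t => ?_))
  induction t with
  | zero => simp
  | tmul x y => exact h x y
  | add t t' ht ht' => simpa using congrArg₂ (· + ·) ht ht'

variable (H K) in
/-- The bilinear map `(S, T) ↦ S ⊗ T`, as a linear map on the tensor product of the algebras of
bounded operators. -/
def tensorOpHom : (H →L[ℂ] H) ⊗[ℂ] (K →L[ℂ] K) →ₗ[ℂ]
    (HilbertTensor H K →L[ℂ] HilbertTensor H K) :=
  TensorProduct.lift <| LinearMap.mk₂ ℂ tensorOp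
    (fun S S' T => hilbertTensor_ext fun x y => by
      simp [tensorOp_toHilbertTensor, TensorProduct.add_tmul])
    (fun c S T => hilbertTensor_ext fun x y => by
      simp [tensorOp_toHilbertTensor, ← TensorProduct.smul_tmul'])
    (fun S T T' => hilbertTensor_ext fun x y => by
      simp [tensorOp_toHilbertTensor, TensorProduct.tmul_add])
    (fun c S T => hilbertTensor_ext fun x y => by
      simp [tensorOp_toHilbertTensor])

@[simp]
lemma tensorOpHom_tmul (S : H →L[ℂ] H) (T : K →L[ℂ] K) :
    tensorOpHom H K (S ⊗ₜ T) = tensorOp S T := rfl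

lemma tensorOp_one_one : tensorOp (1 : H →L[ℂ] H) (1 : K →L[ℂ] K) = 1 :=
  hilbertTensor_ext fun x y => by simp [tensorOp_toHilbertTensor]

lemma tensorOp_mul (S S' : H →L[ℂ] H) (T T' : K →L[ℂ] K) :
    tensorOp S T * tensorOp S' T' = tensorOp (S * S') (T * T') :=
  hilbertTensor_ext fun x y => by simp [tensorOp_toHilbertTensor]

variable (H K) in
/-- The flip `H ⊗ K → K ⊗ H`. -/
def hilbertTensorFlip : HilbertTensor H K →L[ℂ] HilbertTensor K H :=
  ((TensorProduct.commIsometry ℂ H K).toContinuousLinearEquiv :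
    H ⊗[ℂ] K →L[ℂ] K ⊗[ℂ] H).completion

lemma hilbertTensorFlip_tmul (x : H) (y : K) :
    hilbertTensorFlip H K (toHilbertTensor (x ⊗ₜ y)) = toHilbertTensor (y ⊗ₜ x) :=
  ContinuousLinearMap.completion_apply_coe _ (x ⊗ₜ y)

lemma norm_hilbertTensorFlip_le (ξ : HilbertTensor H K) : ‖hilbertTensorFlip H K ξ‖ ≤ ‖ξ‖ := by
  refine denseRange_toHilbertTensor.induction_on (p := fun ξ => ‖hilbertTensorFlip H K ξ‖ ≤ ‖ξ‖) ξ
    (isClosed_le (by fun_prop) (by fun_prop)) fun t => ?_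
  have : hilbertTensorFlip H K (toHilbertTensor t) =
      toHilbertTensor (TensorProduct.commIsometry ℂ H K t) :=
    ContinuousLinearMap.completion_apply_coe _ t
  rw [this, LinearIsometry.norm_map, LinearIsometry.norm_map, LinearIsometryEquiv.norm_map]

/-- Conjugation by the flip lets norm estimates for the left leg be used on the right leg. -/
lemma tensorOpHom_comm (t : (H →L[ℂ] H) ⊗[ℂ] (K →L[ℂ] K)) :
    tensorOpHom K H (TensorProduct.comm ℂ _ _ t) =
      hilbertTensorFlip H K ∘L tensorOpHom H K t ∘L hilbertTensorFlip K H := by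
  induction t with
  | zero =>
    rw [(TensorProduct.comm ℂ (H →L[ℂ] H) (K →L[ℂ] K)).map_zero]
    simp only [LinearMap.map_zero, ContinuousLinearMap.zero_comp, ContinuousLinearMap.comp_zero]
  | tmul S T =>
    exact hilbertTensor_ext fun x y => by simp [tensorOp_toHilbertTensor, hilbertTensorFlip_tmul]
  | add t t' ht ht' =>
    rw [(TensorProduct.comm ℂ (H →L[ℂ] H) (K →L[ℂ] K)).map_add, LinearMap.map_add, ht, ht',
      LinearMap.map_add, ContinuousLinearMap.add_comp, ContinuousLinearMap.comp_add]

lemma norm_tensorOpHom_comm_le (t : (H →L[ℂ] H) ⊗[ℂ] (K →L[ℂ] K)) :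
    ‖tensorOpHom K H (TensorProduct.comm ℂ _ _ t)‖ ≤ ‖tensorOpHom H K t‖ := by
  rw [tensorOpHom_comm]
  refine ContinuousLinearMap.opNorm_le_bound _ (norm_nonneg _) fun ξ => ?_
  exact (norm_hilbertTensorFlip_le _).trans <| ((tensorOpHom H K t).le_opNorm _).trans <|
    mul_le_mul_of_nonneg_left (norm_hilbertTensorFlip_le ξ) (norm_nonneg _)

lemma norm_tensorOpHom_comm (t : (H →L[ℂ] H) ⊗[ℂ] (K →L[ℂ] K)) :
    ‖tensorOpHom K H (TensorProduct.comm ℂ _ _ t)‖ = ‖tensorOpHom H K t‖ := by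
  refine le_antisymm (norm_tensorOpHom_comm_le t) ?_
  simpa [TensorProduct.comm_comm] using norm_tensorOpHom_comm_le (TensorProduct.comm ℂ _ _ t)

end TensorOperators

/-! ### Amplifications of representations to matrix algebras. -/

section Amplification

variable {A : Type*} [CStarAlgebra A] {H : Type*} [NormedAddCommGroup H] [InnerProductSpace ℂ H]
  [CompleteSpace H] {m : Type*} [Fintype m]

/-- The action of a matrix over `A` on `H^m`, for a representation of `A` on `H`. -/
def amplifiedOp (π : A →⋆ₐ[ℂ] (H →L[ℂ] H)) (c : CStarMatrix m m A) :
    PiLp 2 (fun _ : m => H) →L[ℂ] PiLp 2 (fun _ : m => H) :=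
  (PiLp.continuousLinearEquiv 2 ℂ (fun _ : m => H)).symm.toContinuousLinearMap ∘L
    ContinuousLinearMap.pi fun k => ∑ l, π (c k l) ∘L PiLp.proj 2 (fun _ : m => H) l

@[simp]
lemma amplifiedOp_apply (π : A →⋆ₐ[ℂ] (H →L[ℂ] H)) (c : CStarMatrix m m A)
    (x : PiLp 2 (fun _ : m => H)) (k : m) : amplifiedOp π c x k = ∑ l, π (c k l) (x l) := by
  simp [amplifiedOp]

lemma amplifiedOp_one [DecidableEq m] (π : A →⋆ₐ[ℂ] (H →L[ℂ] H)) :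
    amplifiedOp π (1 : CStarMatrix m m A) = 1 := by
  ext x k
  have h : ∀ l, π ((1 : CStarMatrix m m A) k l) (x l) = if k = l then x l else 0 := fun l => by
    rw [CStarMatrix.one_apply]
    split_ifs <;> simp
  simp [h]

/-- The amplification of a representation of `A` on `H` to the representation of the matrix algebra
`M_m(A)` on `H^m`. -/
def amplifiedRep [DecidableEq m] (π : A →⋆ₐ[ℂ] (H →L[ℂ] H)) :
    CStarMatrix m m A →⋆ₐ[ℂ] (PiLp 2 (fun _ : m => H) →L[ℂ] PiLp 2 (fun _ : m => H)) where
  toFun := amplifiedOp π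
  map_one' := amplifiedOp_one π
  map_mul' c d := by
    ext x k
    simp only [amplifiedOp_apply, mul_apply_eq_comp, CStarMatrix.mul_apply, map_sum,
      map_mul, _root_.sum_apply]
    exact Finset.sum_comm
  map_zero' := by ext x k; simp
  map_add' c d := by ext x k; simp [Finset.sum_add_distrib]
  commutes' r := by
    rw [Algebra.algebraMap_eq_smul_one, Algebra.algebraMap_eq_smul_one, ← amplifiedOp_one π]
    ext x k
    simp [Finset.smul_sum]
  map_star' c := by
    rw [ContinuousLinearMap.star_eq_adjoint, ContinuousLinearMap.eq_adjoint_iff]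
    intro x y
    simp only [PiLp.inner_apply, amplifiedOp_apply, sum_inner, inner_sum]
    rw [Finset.sum_comm]
    refine Finset.sum_congr rfl fun k _ => Finset.sum_congr rfl fun l _ => ?_
    rw [CStarMatrix.star_apply, map_star, ContinuousLinearMap.star_eq_adjoint,
      ContinuousLinearMap.adjoint_inner_left]

/-- Applying the operator to vectors supported in coordinate `l` and reading coordinate `k` isolates
one entry. Injectivity is wanted because it makes the amplification isometric. -/
lemma amplifiedRep_injective [DecidableEq m] {π : A →⋆ₐ[ℂ] (H →L[ℂ] H)}
    (hπ : Function.Injective π) : Function.Injective (amplifiedRep (m := m) π) := by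
  rw [injective_iff_map_eq_zero]
  intro c hc
  ext k l
  apply hπ
  rw [CStarMatrix.zero_apply, map_zero]
  ext x
  have h : amplifiedOp π c (PiLp.single 2 l x) k = 0 := by
    rw [show amplifiedOp π c = 0 from hc]; rfl
  have h' : ∀ i, π (c k i) ((PiLp.single 2 l x : PiLp 2 fun _ : m => H) i) =
      if i = l then π (c k i) x else 0 := fun i => by
    rw [PiLp.single_apply]
    split_ifs <;> simp
  rw [amplifiedOp_apply] at h
  simp only [h', Finset.sum_ite_eq', Finset.mem_univ, if_true] at h
  exact h

end Amplification

/-! ### Independence of the spatial norm from the faithful representations. -/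

section SpatialNorm

open scoped InnerProductSpace

/-- Take `z = T x` and cancel a factor `‖T x‖`. -/
lemma opNorm_le_of_inner_le {E F : Type*} [NormedAddCommGroup E] [InnerProductSpace ℂ E]
    [NormedAddCommGroup F] [InnerProductSpace ℂ F] (T : E →L[ℂ] F) {M : ℝ} (hM : 0 ≤ M)
    (h : ∀ x z, ‖⟪z, T x⟫_ℂ‖ ≤ M * ‖z‖ * ‖x‖) : ‖T‖ ≤ M := by
  refine T.opNorm_le_bound hM fun x => ?_
  have h1 := h x (T x)
  rw [inner_self_eq_norm_sq_to_K, norm_pow, RCLike.norm_ofReal, abs_norm, sq] at h1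
  rcases (norm_nonneg (T x)).eq_or_lt with h0 | h0
  · rw [← h0]; positivity
  · exact le_of_mul_le_mul_right (by linarith) h0

variable {H K : Type*} [NormedAddCommGroup H] [InnerProductSpace ℂ H]
  [NormedAddCommGroup K] [InnerProductSpace ℂ K]

/-- By density, algebraic tensors suffice; being finite sums, they allow compression to matrices. -/
lemma opNorm_hilbertTensor_le_of_inner_le (T : HilbertTensor H K →L[ℂ] HilbertTensor H K) {M : ℝ}
    (hM : 0 ≤ M) (h : ∀ t t' : H ⊗[ℂ] K,
      ‖⟪toHilbertTensor t', T (toHilbertTensor t)⟫_ℂ‖ ≤ M * ‖t'‖ * ‖t‖) : ‖T‖ ≤ M := by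
  refine opNorm_le_of_inner_le T hM fun ξ η => ?_
  refine denseRange_toHilbertTensor.induction_on₂
    (p := fun ξ η => ‖⟪η, T ξ⟫_ℂ‖ ≤ M * ‖η‖ * ‖ξ‖) (isClosed_le (by fun_prop) (by fun_prop))
    (fun t t' => ?_) ξ η
  simpa using h t t'

/-- Finitely many (here two) tensors in `H ⊗ K` can be written with a common orthonormal family
in `K`. -/
lemma exists_orthonormal_eq_sum_tmul (t t' : H ⊗[ℂ] K) :
    ∃ (m : ℕ) (e : Fin m → K) (x x' : PiLp 2 (fun _ : Fin m => H)), Orthonormal ℂ e ∧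
      t = ∑ k, x k ⊗ₜ[ℂ] e k ∧ t' = ∑ k, x' k ⊗ₜ[ℂ] e k := by
  -- A finite-dimensional `N` in `K` carries the right legs of both tensors; expanding them in an
  -- orthonormal basis of `N` moves the coefficients into `H`.
  obtain ⟨N, hN, hsub⟩ := TensorProduct.exists_finite_submodule_right_of_setFinite {t, t'}
    (Set.toFinite _)
  let b := stdOrthonormalBasis ℂ N
  have key : ∀ s : H ⊗[ℂ] N, ∃ x : PiLp 2 (fun _ : Fin (Module.finrank ℂ N) => H),
      N.subtype.lTensor H s = ∑ k, x k ⊗ₜ[ℂ] (b k : K) := by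
    intro s
    induction s with
    | zero => exact ⟨0, by simp⟩
    | tmul x y =>
      refine ⟨WithLp.toLp 2 fun k => b.repr y k • x, ?_⟩
      rw [LinearMap.lTensor_tmul]
      conv_lhs => rw [← b.sum_repr y]
      simp [TensorProduct.tmul_sum, ← TensorProduct.smul_tmul']
    | add s s' hs hs' =>
      obtain ⟨x, hx⟩ := hs
      obtain ⟨x', hx'⟩ := hs'
      exact ⟨x + x', by simp [hx, hx', TensorProduct.add_tmul, Finset.sum_add_distrib]⟩
  obtain ⟨s, hs⟩ := hsub (Set.mem_insert t {t'})
  obtain ⟨s', hs'⟩ := hsub (Set.mem_insert_of_mem t rfl)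
  obtain ⟨x, hx⟩ := key s
  obtain ⟨x', hx'⟩ := key s'
  exact ⟨_, fun k => b k, x, x', b.orthonormal.comp_linearIsometry N.subtypeₗᵢ,
    by rw [← hs, hx], by rw [← hs', hx']⟩

lemma norm_sum_tmul_orthonormal {m : Type*} [Fintype m] {e : m → K} (he : Orthonormal ℂ e)
    (x : PiLp 2 (fun _ : m => H)) : ‖∑ k, x k ⊗ₜ[ℂ] e k‖ = ‖x‖ := by
  classical
  have h : ⟪∑ k, x k ⊗ₜ[ℂ] e k, ∑ k, x k ⊗ₜ[ℂ] e k⟫_ℂ = ⟪x, x⟫_ℂ := by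
    rw [PiLp.inner_apply]
    simp [sum_inner, inner_sum, orthonormal_iff_ite.mp he]
  rw [@norm_eq_sqrt_re_inner ℂ, @norm_eq_sqrt_re_inner ℂ _ _ _ _ x, h]

variable {A : Type*} [CStarAlgebra A]

variable (A) in
/-- The slice map `a ⊗ T ↦ ⟪y', T y⟫ a`. -/
def vectorSlice (y' y : K) : A ⊗[ℂ] (K →L[ℂ] K) →ₗ[ℂ] A :=
  (TensorProduct.rid ℂ A).toLinearMap ∘ₗ
    ((innerSL ℂ y').toLinearMap ∘ₗ (ContinuousLinearMap.apply ℂ K y).toLinearMap).lTensor A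

lemma vectorSlice_tmul (y' y : K) (a : A) (T : K →L[ℂ] K) :
    vectorSlice A y' y (a ⊗ₜ T) = ⟪y', T y⟫_ℂ • a := by
  simp [vectorSlice]

variable [CompleteSpace H]

/-- The operator `∑ π (a_i) ⊗ T_i` on `H ⊗ K` given by a tensor `∑ a_i ⊗ T_i` and a representation
`π` on `H`. -/
def leftRep (π : A →⋆ₐ[ℂ] (H →L[ℂ] H)) : A ⊗[ℂ] (K →L[ℂ] K) →ₗ[ℂ]
    (HilbertTensor H K →L[ℂ] HilbertTensor H K) :=
  tensorOpHom H K ∘ₗ π.toAlgHom.toLinearMap.rTensor (K →L[ℂ] K)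

@[simp]
lemma leftRep_tmul (π : A →⋆ₐ[ℂ] (H →L[ℂ] H)) (a : A) (T : K →L[ℂ] K) :
    leftRep π (a ⊗ₜ T) = tensorOp (π a) T := rfl

/-- Slicing out `K` leaves an element of `A` that does not depend on `π`. -/
lemma inner_leftRep_tmul (π : A →⋆ₐ[ℂ] (H →L[ℂ] H)) (t : A ⊗[ℂ] (K →L[ℂ] K)) (x x' : H)
    (y y' : K) : ⟪toHilbertTensor (x' ⊗ₜ y'), leftRep π t (toHilbertTensor (x ⊗ₜ y))⟫_ℂ =
      ⟪x', π (vectorSlice A y' y t) x⟫_ℂ := by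
  induction t with
  | zero => simp
  | tmul a T =>
    rw [leftRep_tmul, tensorOp_toHilbertTensor, LinearIsometry.inner_map_map, vectorSlice_tmul]
    simp [mul_comm]
  | add t t' ht ht' => simp [ht, ht']

/-- The matrix of slices depends on `t` and `e` alone, so different representations of `A` can be
compared through their amplifications at one matrix. -/
lemma inner_leftRep_sum_tmul {m : Type*} [Fintype m] (π : A →⋆ₐ[ℂ] (H →L[ℂ] H))
    (t : A ⊗[ℂ] (K →L[ℂ] K)) (e : m → K) (x x' : PiLp 2 (fun _ : m => H)) :
    ⟪toHilbertTensor (∑ k, x' k ⊗ₜ e k), leftRep π t (toHilbertTensor (∑ k, x k ⊗ₜ e k))⟫_ℂ =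
      ⟪x', amplifiedOp π (CStarMatrix.ofMatrix fun k l => vectorSlice A (e k) (e l) t) x⟫_ℂ := by
  simp only [map_sum, sum_inner, inner_sum, inner_leftRep_tmul, PiLp.inner_apply,
    amplifiedOp_apply]
  exact Finset.sum_comm

section

attribute [local instance] CStarAlgebra.spectralOrder CStarAlgebra.spectralOrderedRing

/-- The norm of `∑ ρ (a_i) ⊗ T_i` for a faithful representation `ρ` dominates the norm of
`∑ π (a_i) ⊗ T_i` for every representation `π`. -/
lemma norm_leftRep_le {L : Type*} [NormedAddCommGroup L] [InnerProductSpace ℂ L] [CompleteSpace L]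
    (π : A →⋆ₐ[ℂ] (H →L[ℂ] H)) {ρ : A →⋆ₐ[ℂ] (L →L[ℂ] L)} (hρ : Function.Injective ρ)
    (t : A ⊗[ℂ] (K →L[ℂ] K)) : ‖leftRep π t‖ ≤ ‖leftRep ρ t‖ := by
  refine opNorm_hilbertTensor_le_of_inner_le _ (norm_nonneg _) fun s s' => ?_
  obtain ⟨m, e, x, x', he, rfl, rfl⟩ := exists_orthonormal_eq_sum_tmul s s'
  rw [inner_leftRep_sum_tmul, norm_sum_tmul_orthonormal he, norm_sum_tmul_orthonormal he]
  set c : CStarMatrix (Fin m) (Fin m) A :=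
    CStarMatrix.ofMatrix fun k l => vectorSlice A (e k) (e l) t with hc
  -- `*`-homomorphisms of C*-algebras are contractive, and isometric when injective.
  have h1 : ‖amplifiedOp π c‖ ≤ ‖c‖ := NonUnitalStarAlgHom.norm_apply_le (amplifiedRep π) c
  have h2 : ‖amplifiedOp ρ c‖ = ‖c‖ :=
    NonUnitalStarAlgHom.norm_map (amplifiedRep ρ) (amplifiedRep_injective hρ) c
  -- Up to the isometry given by `e`, the left operator is a compression of the right one.
  have h3 : ‖amplifiedOp ρ c‖ ≤ ‖leftRep ρ t‖ := by
    refine opNorm_le_of_inner_le _ (norm_nonneg _) fun z z' => ?_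
    rw [hc, ← inner_leftRep_sum_tmul, ← norm_sum_tmul_orthonormal he z,
      ← norm_sum_tmul_orthonormal he z', ← toHilbertTensor.norm_map (∑ k, z k ⊗ₜ[ℂ] e k),
      ← toHilbertTensor.norm_map (∑ k, z' k ⊗ₜ[ℂ] e k)]
    refine (norm_inner_le_norm _ _).trans ?_
    rw [mul_comm ‖leftRep ρ t‖, mul_assoc]
    exact mul_le_mul_of_nonneg_left ((leftRep ρ t).le_opNorm _) (norm_nonneg _)
  refine (norm_inner_le_norm _ _).trans ?_
  rw [mul_comm ‖leftRep ρ t‖, mul_assoc]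
  exact mul_le_mul_of_nonneg_left
    ((amplifiedOp π c).le_of_opNorm_le (h1.trans (h2.symm.le.trans h3)) x) (norm_nonneg _)

end

variable [CompleteSpace K] {B : Type*} [CStarAlgebra B]

/-- The operator `∑ π (a_i) ⊗ σ (b_i)` given by a tensor `∑ a_i ⊗ b_i`. -/
def spatialRep (π : A →⋆ₐ[ℂ] (H →L[ℂ] H)) (σ : B →⋆ₐ[ℂ] (K →L[ℂ] K)) : A ⊗[ℂ] B →ₗ[ℂ]
    (HilbertTensor H K →L[ℂ] HilbertTensor H K) :=
  tensorOpHom H K ∘ₗ TensorProduct.map π.toAlgHom.toLinearMap σ.toAlgHom.toLinearMap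

@[simp]
lemma spatialRep_tmul (π : A →⋆ₐ[ℂ] (H →L[ℂ] H)) (σ : B →⋆ₐ[ℂ] (K →L[ℂ] K)) (a : A) (b : B) :
    spatialRep π σ (a ⊗ₜ b) = tensorOp (π a) (σ b) := rfl

lemma spatialRep_eq_leftRep (π : A →⋆ₐ[ℂ] (H →L[ℂ] H)) (σ : B →⋆ₐ[ℂ] (K →L[ℂ] K))
    (t : A ⊗[ℂ] B) :
    spatialRep π σ t = leftRep π (σ.toAlgHom.toLinearMap.lTensor A t) := by
  rw [spatialRep, leftRep, LinearMap.comp_apply, LinearMap.comp_apply,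
    ← LinearMap.comp_apply (LinearMap.rTensor _ _), LinearMap.rTensor_comp_lTensor]

lemma norm_spatialRep_comm (π : A →⋆ₐ[ℂ] (H →L[ℂ] H)) (σ : B →⋆ₐ[ℂ] (K →L[ℂ] K))
    (t : A ⊗[ℂ] B) : ‖spatialRep σ π (TensorProduct.comm ℂ A B t)‖ = ‖spatialRep π σ t‖ := by
  rw [spatialRep, spatialRep, LinearMap.comp_apply, LinearMap.comp_apply, TensorProduct.map_comm,
    norm_tensorOpHom_comm]

/-- The spatial norm given by faithful representations dominates the norm given by any other
representations. -/
lemma norm_spatialRep_le {H' K' : Type*} [NormedAddCommGroup H'] [InnerProductSpace ℂ H']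
    [CompleteSpace H'] [NormedAddCommGroup K'] [InnerProductSpace ℂ K'] [CompleteSpace K']
    (π : A →⋆ₐ[ℂ] (H →L[ℂ] H)) (σ : B →⋆ₐ[ℂ] (K →L[ℂ] K))
    {π' : A →⋆ₐ[ℂ] (H' →L[ℂ] H')} {σ' : B →⋆ₐ[ℂ] (K' →L[ℂ] K')} (hπ' : Function.Injective π')
    (hσ' : Function.Injective σ') (t : A ⊗[ℂ] B) : ‖spatialRep π σ t‖ ≤ ‖spatialRep π' σ' t‖ := by
  -- Replace `π` first, then flip, replace `σ`, and flip back.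
  calc ‖spatialRep π σ t‖ ≤ ‖spatialRep π' σ t‖ := by
        rw [spatialRep_eq_leftRep, spatialRep_eq_leftRep]
        exact norm_leftRep_le π hπ' _
    _ = ‖spatialRep σ π' (TensorProduct.comm ℂ A B t)‖ := (norm_spatialRep_comm _ _ _).symm
    _ ≤ ‖spatialRep σ' π' (TensorProduct.comm ℂ A B t)‖ := by
        rw [spatialRep_eq_leftRep, spatialRep_eq_leftRep]
        exact norm_leftRep_le σ hσ' _
    _ = ‖spatialRep π' σ' t‖ := norm_spatialRep_comm _ _ _

/-- A functional on `A ⊗ B` dominated by the norm in some representation is given by a state on the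
operators of any faithful representation. -/
lemma exists_state_spatialRep {H' K' : Type*} [NormedAddCommGroup H'] [InnerProductSpace ℂ H']
    [CompleteSpace H'] [NormedAddCommGroup K'] [InnerProductSpace ℂ K'] [CompleteSpace K']
    (π : A →⋆ₐ[ℂ] (H →L[ℂ] H)) (σ : B →⋆ₐ[ℂ] (K →L[ℂ] K))
    {π' : A →⋆ₐ[ℂ] (H' →L[ℂ] H')} {σ' : B →⋆ₐ[ℂ] (K' →L[ℂ] K')} (hπ' : Function.Injective π')
    (hσ' : Function.Injective σ') (f : A ⊗[ℂ] B →ₗ[ℂ] ℂ) (hf : ∀ t, ‖f t‖ ≤ ‖spatialRep π σ t‖)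
    (hf1 : f (1 ⊗ₜ 1) = 1) :
    ∃ φ : State (HilbertTensor H' K' →L[ℂ] HilbertTensor H' K'),
      ∀ a b, φ (tensorOp (π' a) (σ' b)) = f (a ⊗ₜ b) := by
  obtain ⟨φ, hφ⟩ := exists_state_comp_eq (spatialRep π' σ') f
    (fun t => (hf t).trans (norm_spatialRep_le π σ hπ' hσ' t)) (e := 1 ⊗ₜ 1)
    (by rw [spatialRep_tmul, map_one, map_one, tensorOp_one_one]) hf1
  exact ⟨φ, fun a b => hφ (a ⊗ₜ b)⟩

/-- The restriction of a state to a unital `*`-subalgebra. -/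
def State.restrict {R : Type*} [Ring R] [StarRing R] [Algebra ℂ R] [StarModule ℂ R] (φ : State R)
    (S : StarSubalgebra ℂ R) : State S where
  toLinearMap := φ.toLinearMap ∘ₗ S.subtype.toAlgHom.toLinearMap
  map_one' := φ.map_one'
  nonneg' a := φ.nonneg' a

/-- Transfer of a state along representations of a pair of algebras into a pair of algebras. -/
lemma exists_state_minTensor {A₀ B₀ : Type*} [CStarAlgebra A₀] [CStarAlgebra B₀]
    (α : A →⋆ₐ[ℂ] A₀) (β : B →⋆ₐ[ℂ] B₀) (φ : State (MinTensor A₀ B₀))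
    {π' : A →⋆ₐ[ℂ] (H →L[ℂ] H)} {σ' : B →⋆ₐ[ℂ] (K →L[ℂ] K)} (hπ' : Function.Injective π')
    (hσ' : Function.Injective σ') :
    ∃ ψ : State (HilbertTensor H K →L[ℂ] HilbertTensor H K),
      ∀ a b, ψ (tensorOp (π' a) (σ' b)) = φ (minTmul (α a) (β b)) := by
  let Θ := spatialRep ((universalRep A₀).comp α) ((universalRep B₀).comp β)
  have hmem : ∀ t, Θ t ∈ MinTensor A₀ B₀ := by
    intro t
    induction t with
    | zero => rw [map_zero]; exact zero_mem _
    | tmul a b => exact (minTmul (α a) (β b)).2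
    | add t t' ht ht' => rw [map_add]; exact add_mem ht ht'
  -- Closedness makes `MinTensor A₀ B₀` a C*-algebra, so that `φ` is contractive on it.
  have : IsClosed (MinTensor A₀ B₀ : Set (HilbertTensor (UniversalSpace A₀) (UniversalSpace B₀)
      →L[ℂ] HilbertTensor (UniversalSpace A₀) (UniversalSpace B₀))) :=
    StarSubalgebra.isClosed_topologicalClosure _
  let Θ' : A ⊗[ℂ] B →ₗ[ℂ] MinTensor A₀ B₀ :=
    { toFun := fun t => ⟨Θ t, hmem t⟩
      map_add' := fun s t => Subtype.ext (map_add Θ s t)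
      map_smul' := fun c t => Subtype.ext (map_smul Θ c t) }
  have hone : Θ' (1 ⊗ₜ 1) = 1 := Subtype.ext (by
    change Θ (1 ⊗ₜ 1) = 1
    rw [spatialRep_tmul, map_one, map_one, tensorOp_one_one])
  -- `α` and `β` need not be injective: only the dominating pair `π'`, `σ'` has to be faithful.
  exact exists_state_spatialRep _ _ hπ' hσ' (φ.toLinearMap ∘ₗ Θ') (fun t => φ.norm_apply_le (Θ' t))
    (by rw [LinearMap.comp_apply, hone]; exact φ.map_one')

end SpatialNorm

/-! ### Evaluation of noncommutative `*`-polynomials. -/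

namespace FreeStarAlgebra

variable {X C : Type*} [Ring C] [StarRing C]

/-- The evaluation of a word at elements `c x` of a `*`-algebra. -/
def wordEval (c : X → C) : FreeMonoid (X × Bool) →* C :=
  FreeMonoid.lift fun p => if p.2 then star (c p.1) else c p.1

lemma wordEval_adjointWord (c : X → C) (w : FreeMonoid (X × Bool)) :
    wordEval c (adjointWord w) = star (wordEval c w) := by
  induction w using FreeMonoid.inductionOn' with
  | one =>
    rw [map_one, star_one, show adjointWord (1 : FreeMonoid (X × Bool)) = 1 from rfl, map_one]
  | of_mul a w ih =>
    have h : adjointWord (FreeMonoid.of a) = FreeMonoid.of (a.1, !a.2) := rfl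
    rw [adjointWord_mul, map_mul, map_mul, ih, star_mul, h, wordEval, FreeMonoid.lift_eval_of,
      FreeMonoid.lift_eval_of]
    obtain ⟨x, b⟩ := a
    cases b <;> simp

variable [Algebra ℂ C]

/-- The evaluation of noncommutative polynomials, as an algebra homomorphism. -/
def evalAlgHom (c : X → C) : FreeStarAlgebra X →ₐ[ℂ] C :=
  MonoidAlgebra.lift ℂ C (FreeMonoid (X × Bool)) (wordEval c)

lemma evalAlgHom_monomial (c : X → C) (w : FreeMonoid (X × Bool)) (d : ℂ) :
    evalAlgHom c (monomial w d) = d • wordEval c w :=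
  MonoidAlgebra.lift_single _ _ _

/-- The evaluation of noncommutative polynomials, as a `*`-homomorphism. -/
def eval [StarModule ℂ C] (c : X → C) : FreeStarAlgebra X →⋆ₐ[ℂ] C where
  __ := evalAlgHom c
  map_star' f := by
    change evalAlgHom c (star f) = star (evalAlgHom c f)
    refine induction (P := fun f => evalAlgHom c (star f) = star (evalAlgHom c f)) f ?_
      (fun f g hf hg => ?_) fun w d => ?_
    · rw [star_zero', map_zero, star_zero]
    · rw [star_add', map_add, map_add, hf, hg, star_add]
    · rw [star_monomial, evalAlgHom_monomial, evalAlgHom_monomial, wordEval_adjointWord, star_smul]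

@[simp]
lemma eval_gen [StarModule ℂ C] (c : X → C) (x : X) : eval c (gen x) = c x := by
  refine (evalAlgHom_monomial c _ _).trans ?_
  rw [one_smul, wordEval, FreeMonoid.lift_eval_of]
  rfl

end FreeStarAlgebra

/-! ### Extension of `*`-homomorphisms to completions. -/

namespace CStarSeminorm

variable {R : Type*} [Ring R] [StarRing R] [Algebra ℂ R]

/-- The C*-seminorm induced by a `*`-homomorphism into a C*-algebra. -/
def ofHom {C : Type*} [CStarAlgebra C] (f : R →⋆ₐ[ℂ] C) : CStarSeminorm R where
  toSeminorm := (normSeminorm ℂ C).comp f.toAlgHom.toLinearMap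
  mul_le' x y := by
    change ‖f (x * y)‖ ≤ ‖f x‖ * ‖f y‖
    rw [map_mul]
    exact norm_mul_le _ _
  star_mul_self' x := by
    change ‖f (star x * x)‖ = ‖f x‖ * ‖f x‖
    rw [map_mul, StarHomClass.map_star, CStarRing.norm_star_mul_self]

variable (p : CStarSeminorm R)

lemma toCompletion_sub (x y : R) :
    p.toCompletion (x - y) = p.toCompletion x - p.toCompletion y :=
  UniformSpace.Completion.coe_sub (p.toPre x) (p.toPre y)

lemma toCompletion_sum {ι : Type*} (s : Finset ι) (x : ι → R) :
    p.toCompletion (∑ i ∈ s, x i) = ∑ i ∈ s, p.toCompletion (x i) :=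
  map_sum (AddMonoidHom.mk' p.toCompletion p.toCompletion_add) x s

variable {C : Type*} [CStarAlgebra C] (f : R →⋆ₐ[ℂ] C)

/-- A `*`-homomorphism on `R`, as a ring homomorphism on the seminormed ring `p.Pre`. -/
def preHom : p.Pre →+* C := f.toAlgHom.toRingHom

lemma continuous_preHom (hf : ∀ x, ‖f x‖ ≤ p.toSeminorm x) : Continuous (p.preHom f) := by
  refine AddMonoidHomClass.continuous_of_bound (p.preHom f) 1 fun x => ?_
  rw [one_mul]
  exact hf x

variable (hf : ∀ x, ‖f x‖ ≤ p.toSeminorm x)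

/-- The extension to the completion of a `*`-homomorphism dominated by a C*-seminorm, as a ring
homomorphism. -/
def liftRingHom : p.Completion →+* C :=
  UniformSpace.Completion.extensionHom (p.preHom f) (p.continuous_preHom f hf)

lemma liftRingHom_toCompletion (x : R) : p.liftRingHom f hf (p.toCompletion x) = f x :=
  UniformSpace.Completion.extensionHom_coe (p.preHom f) (p.continuous_preHom f hf)
    (p.toPre x)

lemma continuous_liftRingHom : Continuous (p.liftRingHom f hf) :=
  UniformSpace.Completion.continuous_extension

/-- The extension to the completion of a `*`-homomorphism dominated by a C*-seminorm. -/
def lift [StarModule ℂ R] : p.Completion →⋆ₐ[ℂ] C where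
  __ := p.liftRingHom f hf
  commutes' r := by
    have : algebraMap ℂ p.Completion r = p.toCompletion (algebraMap ℂ R r) := by
      rw [Algebra.algebraMap_eq_smul_one, Algebra.algebraMap_eq_smul_one, toCompletion_smul,
        toCompletion_one]
    rw [this]
    exact (p.liftRingHom_toCompletion f hf _).trans (AlgHomClass.commutes f r)
  map_star' x := by
    have h1 := p.continuous_liftRingHom f hf
    have h2 := p.continuous_star
    change p.liftRingHom f hf (star x) = star (p.liftRingHom f hf x)
    refine p.completion_induction
      (P := fun x => p.liftRingHom f hf (star x) = star (p.liftRingHom f hf x)) x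
      (isClosed_eq (by fun_prop) (by fun_prop)) fun x => ?_
    rw [star_toCompletion, liftRingHom_toCompletion, liftRingHom_toCompletion,
      StarHomClass.map_star]

lemma lift_toCompletion [StarModule ℂ R] (x : R) : p.lift f hf (p.toCompletion x) = f x :=
  p.liftRingHom_toCompletion f hf x

end CStarSeminorm

/-! ### The universal property of the Brown algebra. -/

section BrownUniversal

open FreeStarAlgebra

variable {n : ℕ} {C : Type*} [CStarAlgebra C] {U : Matrix (Fin n) (Fin n) C}

lemma unitary_matrix_mul_star (hU : U ∈ unitary (Matrix (Fin n) (Fin n) C)) (i l : Fin n) :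
    ∑ k, U i k * star (U l k) = if i = l then 1 else 0 := by
  have h := congrFun (congrFun (Unitary.mem_iff.mp hU).2 i) l
  rwa [Matrix.mul_apply, Matrix.one_apply] at h

lemma unitary_matrix_star_mul (hU : U ∈ unitary (Matrix (Fin n) (Fin n) C)) (k l : Fin n) :
    ∑ i, star (U i k) * U i l = if k = l then 1 else 0 := by
  have h := congrFun (congrFun (Unitary.mem_iff.mp hU).1 k) l
  rwa [Matrix.mul_apply, Matrix.one_apply] at h

/-- The seminorm in `BrownSeminorm n` given by the entries of a unitary matrix. -/
def BrownSeminorm.ofUnitary (hU : U ∈ unitary (Matrix (Fin n) (Fin n) C)) : BrownSeminorm n where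
  toCStarSeminorm := CStarSeminorm.ofHom (eval fun p : Fin n × Fin n => U p.1 p.2)
  rel_mul_star i l := by
    change ‖eval (fun p : Fin n × Fin n => U p.1 p.2) _‖ = 0
    rw [norm_eq_zero, map_sub, map_sum, sub_eq_zero]
    simp only [map_mul, map_star, eval_gen, unitary_matrix_mul_star hU, apply_ite (eval _),
      map_one, map_zero]
  rel_star_mul k l := by
    change ‖eval (fun p : Fin n × Fin n => U p.1 p.2) _‖ = 0
    rw [norm_eq_zero, map_sub, map_sum, sub_eq_zero]
    simp only [map_mul, map_star, eval_gen, unitary_matrix_star_mul hU, apply_ite (eval _),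
      map_one, map_zero]

/-- The universal property of the Brown algebra. -/
def brownLift (hU : U ∈ unitary (Matrix (Fin n) (Fin n) C)) : BrownAlgebra n →⋆ₐ[ℂ] C :=
  -- The norm after evaluation at `U` is one of the seminorms in the supremum, hence dominated by
  -- it.
  (brownUniversalSeminorm n).lift (eval fun p : Fin n × Fin n => U p.1 p.2) fun x =>
    le_ciSup (BrownSeminorm.bddAbove x) (BrownSeminorm.ofUnitary hU)

@[simp]
lemma brownLift_brownGen (hU : U ∈ unitary (Matrix (Fin n) (Fin n) C)) (i j : Fin n) :
    brownLift hU (brownGen i j) = U i j :=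
  ((brownUniversalSeminorm n).lift_toCompletion _ _ _).trans (eval_gen _ _)

/-- The universal seminorm is the supremum of all these seminorms. This is how the unitarity
relations pass to the canonical generators. -/
lemma brown_toCompletion_eq_zero {x : FreeStarAlgebra (Fin n × Fin n)}
    (hx : ∀ p : BrownSeminorm n, p.toSeminorm x = 0) :
    (brownUniversalSeminorm n).toCompletion x = 0 := by
  rw [← norm_eq_zero, CStarSeminorm.norm_toCompletion]
  change (⨆ p : BrownSeminorm n, p.toSeminorm x) = 0
  simp [hx]

lemma brown_toCompletion_ite (P : Prop) [Decidable P] :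
    (brownUniversalSeminorm n).toCompletion (if P then 1 else 0) = if P then 1 else 0 := by
  split_ifs
  · rfl
  · exact brown_toCompletion_eq_zero fun p => map_zero _

lemma brownGen_mem_unitary :
    (brownGen : Matrix (Fin n) (Fin n) (BrownAlgebra n)) ∈ unitary _ := by
  rw [Unitary.mem_iff]
  constructor
  · ext k l
    have h := brown_toCompletion_eq_zero fun p => p.rel_star_mul k l
    simp only [CStarSeminorm.toCompletion_sub, CStarSeminorm.toCompletion_sum,
      CStarSeminorm.toCompletion_mul, ← CStarSeminorm.star_toCompletion, brown_toCompletion_ite,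
      sub_eq_zero] at h
    rw [Matrix.mul_apply, Matrix.one_apply]
    exact h
  · ext i l
    have h := brown_toCompletion_eq_zero fun p => p.rel_mul_star i l
    simp only [CStarSeminorm.toCompletion_sub, CStarSeminorm.toCompletion_sum,
      CStarSeminorm.toCompletion_mul, ← CStarSeminorm.star_toCompletion, brown_toCompletion_ite,
      sub_eq_zero] at h
    rw [Matrix.mul_apply, Matrix.one_apply]
    exact h

end BrownUniversal

/-! ### The conjugation in matrix coordinates. -/

section Formula

variable {n : ℕ}

section Algebraic

variable {C : Type*} [Ring C] [Algebra ℂ C]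

/-- Distributivity alone; the sums are ordered as in `ChannelFormula`, with both outer factors
before the inner ones. -/
lemma sum_mul_sum_conj {R ι : Type*} [Ring R] [Fintype ι] (x y y' x' : ι → ι → R) (z : R) :
    (∑ i, ∑ j, x i j) * (∑ p, ∑ r, y p r) * z * (∑ s, ∑ t, y' s t) * (∑ k, ∑ l, x' k l) =
      ∑ i, ∑ j, ∑ k, ∑ l, ∑ p, ∑ r, ∑ s, ∑ t, x i j * (y p r * z * y' s t) * x' k l := by
  have hm : (∑ p, ∑ r, y p r) * z * (∑ s, ∑ t, y' s t) =
      ∑ p, ∑ r, ∑ s, ∑ t, y p r * z * y' s t := by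
    simp only [Finset.sum_mul]
    simp only [Finset.mul_sum]
  rw [mul_assoc (∑ i, ∑ j, x i j), mul_assoc (∑ i, ∑ j, x i j), hm, Finset.sum_mul, Finset.sum_mul]
  refine Finset.sum_congr rfl fun i _ => ?_
  rw [Finset.sum_mul, Finset.sum_mul]
  refine Finset.sum_congr rfl fun j _ => ?_
  rw [Finset.mul_sum]
  refine Finset.sum_congr rfl fun k _ => ?_
  rw [Finset.mul_sum]
  refine Finset.sum_congr rfl fun l _ => ?_
  simp only [Finset.mul_sum, Finset.sum_mul]

lemma tmul_tmul_mul_tmul_tmul (g g' h h' : Mat n) (c c' : C) :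
    (g ⊗ₜ[ℂ] (c ⊗ₜ[ℂ] h)) * (g' ⊗ₜ[ℂ] (c' ⊗ₜ[ℂ] h')) =
      (g * g') ⊗ₜ[ℂ] ((c * c') ⊗ₜ[ℂ] (h * h')) :=
  (Algebra.TensorProduct.tmul_mul_tmul _ _ _ _).trans
    (congrArg ((g * g') ⊗ₜ[ℂ] ·) (Algebra.TensorProduct.tmul_mul_tmul _ _ _ _))

lemma conj_amplification_eq_sum (a b b' a' : Fin n → Fin n → C) (g h : Mat n) :
    (∑ i, ∑ j, matUnit i j ⊗ₜ[ℂ] (a i j ⊗ₜ[ℂ] (1 : Mat n))) *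
        (∑ k, ∑ l, (1 : Mat n) ⊗ₜ[ℂ] (b k l ⊗ₜ[ℂ] matUnit k l)) * (g ⊗ₜ (1 ⊗ₜ h)) *
        (∑ k, ∑ l, (1 : Mat n) ⊗ₜ[ℂ] (b' k l ⊗ₜ[ℂ] matUnit k l)) *
        (∑ i, ∑ j, matUnit i j ⊗ₜ[ℂ] (a' i j ⊗ₜ[ℂ] (1 : Mat n))) =
      ∑ i, ∑ j, ∑ k, ∑ l, ∑ p, ∑ r, ∑ s, ∑ t, (matUnit i j * g * matUnit k l) ⊗ₜ[ℂ]
        ((a i j * (b p r * b' s t) * a' k l) ⊗ₜ[ℂ] (matUnit p r * h * matUnit s t)) := by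
  refine (sum_mul_sum_conj (R := Mat n ⊗[ℂ] (C ⊗[ℂ] Mat n)) _ _ _ _ _).trans ?_
  simp only [tmul_tmul_mul_tmul_tmul, one_mul, mul_one]

lemma productFunctional_conj_amplification (ω : Mat n ⊗[ℂ] Mat n →ₗ[ℂ] ℂ) (φ : C →ₗ[ℂ] ℂ)
    (a b b' a' : Fin n → Fin n → C) (g h : Mat n) :
    productFunctional ω φ ((∑ i, ∑ j, matUnit i j ⊗ₜ[ℂ] (a i j ⊗ₜ[ℂ] (1 : Mat n))) *
        (∑ k, ∑ l, (1 : Mat n) ⊗ₜ[ℂ] (b k l ⊗ₜ[ℂ] matUnit k l)) * (g ⊗ₜ (1 ⊗ₜ h)) *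
        (∑ k, ∑ l, (1 : Mat n) ⊗ₜ[ℂ] (b' k l ⊗ₜ[ℂ] matUnit k l)) *
        (∑ i, ∑ j, matUnit i j ⊗ₜ[ℂ] (a' i j ⊗ₜ[ℂ] (1 : Mat n)))) =
      ∑ i, ∑ j, ∑ k, ∑ l, ∑ p, ∑ r, ∑ s, ∑ t,
        ω ((matUnit i j * g * matUnit k l) ⊗ₜ (matUnit p r * h * matUnit s t)) *
          φ (a i j * (b p r * b' s t) * a' k l) := by
  rw [conj_amplification_eq_sum]
  simp only [map_sum, productFunctional_tmul]

end Algebraic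

variable {HA HB : Type*} [NormedAddCommGroup HA] [InnerProductSpace ℂ HA] [CompleteSpace HA]
  [NormedAddCommGroup HB] [InnerProductSpace ℂ HB] [CompleteSpace HB]

/-- The product functional at the conjugated element, in matrix coordinates. -/
lemma productFunctional_conj (ω : Mat n ⊗[ℂ] Mat n →ₗ[ℂ] ℂ)
    (φ : (HilbertTensor HA HB →L[ℂ] HilbertTensor HA HB) →ₗ[ℂ] ℂ)
    (U : Matrix (Fin n) (Fin n) (HA →L[ℂ] HA)) (V : Matrix (Fin n) (Fin n) (HB →L[ℂ] HB))
    (g h : Mat n) :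
    productFunctional ω φ
        (ampLeft U * ampRight V * (g ⊗ₜ (1 ⊗ₜ h)) * ampRight (star V) * ampLeft (star U)) =
      ∑ i, ∑ j, ∑ k, ∑ l, ∑ p, ∑ r, ∑ s, ∑ t,
        ω ((matUnit i j * g * matUnit k l) ⊗ₜ (matUnit p r * h * matUnit s t)) *
          φ (tensorOp (U i j * star (U l k)) (V p r * star (V t s))) := by
  refine (productFunctional_conj_amplification ω φ (fun i j => tensorOp (U i j) 1)
    (fun i j => tensorOp 1 (V i j)) (fun i j => tensorOp 1 (star V i j))
    (fun i j => tensorOp (star U i j) 1) g h).trans ?_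
  -- The entries of `U` and `V` act on different legs, so the fourfold product collapses to one
  -- `tensorOp`; the adjoint matrices account for the swapped indices `l k` and `t s`.
  simp only [tensorOp_mul, one_mul, mul_one, Matrix.star_apply]

end Formula

/-! ### Hilbert spaces in larger universes. -/

section UniverseLift

universe w

variable {H : Type*} [NormedAddCommGroup H] [InnerProductSpace ℂ H]

variable (H) in
/-- A copy of a Hilbert space in a larger universe. -/
abbrev HilbertLift : Type _ := PiLp 2 fun _ : PUnit.{w + 1} => H

variable (H) in
/-- A Hilbert space is isometric to its copy in a larger universe. -/
def hilbertLiftEquiv : HilbertLift.{w} H ≃ₗᵢ[ℂ] H where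
  toLinearEquiv := (PiLp.equivOfUnique 2 ℂ fun _ : PUnit.{w + 1} => H).toLinearEquiv
  norm_map' x := by
    rw [PiLp.norm_eq_of_L2]
    simp

variable [CompleteSpace H] {A : Type*} [CStarAlgebra A]

/-- A representation, on a copy of its Hilbert space in a larger universe. -/
def liftRep (π : A →⋆ₐ[ℂ] (H →L[ℂ] H)) :
    A →⋆ₐ[ℂ] (HilbertLift.{w} H →L[ℂ] HilbertLift.{w} H) :=
  ((hilbertLiftEquiv.{w} H).symm.conjStarAlgEquiv : (H →L[ℂ] H) →⋆ₐ[ℂ] _).comp π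

lemma liftRep_injective {π : A →⋆ₐ[ℂ] (H →L[ℂ] H)} (hπ : Function.Injective π) :
    Function.Injective (liftRep.{w} π) :=
  (hilbertLiftEquiv.{w} H).symm.conjStarAlgEquiv.injective.comp hπ

end UniverseLift

/-! ### Pulling back and extending states on minimal tensor products. -/

section StateTransfer

universe w w'

variable {A B : Type*} [CStarAlgebra A] [CStarAlgebra B]

lemma restrict_minTensor_minTmul
    (ψ : State (HilbertTensor (UniversalSpace A) (UniversalSpace B) →L[ℂ]
      HilbertTensor (UniversalSpace A) (UniversalSpace B))) (a : A) (b : B) :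
    ψ.restrict (MinTensor A B) (minTmul a b) = ψ (tensorOp (universalRep A a) (universalRep B b)) :=
  rfl

/-- Composition of a state with `a ⊗ b ↦ π a ⊗ σ b`, as a state on `A ⊗_min B`. -/
lemma exists_state_minTensor_of_rep {H K : Type*} [NormedAddCommGroup H] [InnerProductSpace ℂ H]
    [CompleteSpace H] [NormedAddCommGroup K] [InnerProductSpace ℂ K] [CompleteSpace K]
    (π : A →⋆ₐ[ℂ] (H →L[ℂ] H)) (σ : B →⋆ₐ[ℂ] (K →L[ℂ] K))
    (φ : State (HilbertTensor H K →L[ℂ] HilbertTensor H K)) :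
    ∃ ψ : State (MinTensor A B), ∀ a b, ψ (minTmul a b) = φ (tensorOp (π a) (σ b)) := by
  obtain ⟨ψ, hψ⟩ := exists_state_spatialRep π σ (universalRep_injective (C := A))
    (universalRep_injective (C := B)) (φ.toLinearMap ∘ₗ spatialRep π σ)
    (fun t => φ.norm_apply_le _)
    (by
      rw [LinearMap.comp_apply, spatialRep_tmul, map_one, map_one, tensorOp_one_one]
      exact φ.map_one')
  exact ⟨ψ.restrict (MinTensor A B), fun a b => (restrict_minTensor_minTmul ψ a b).trans (hψ a b)⟩

/-- Composition of a state with `a ⊗ b ↦ α a ⊗ β b`, as a state on `A ⊗_min B`. -/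
lemma exists_state_minTensor_of_hom {A₀ B₀ : Type*} [CStarAlgebra A₀] [CStarAlgebra B₀]
    (α : A →⋆ₐ[ℂ] A₀) (β : B →⋆ₐ[ℂ] B₀) (φ : State (MinTensor A₀ B₀)) :
    ∃ ψ : State (MinTensor A B), ∀ a b, ψ (minTmul a b) = φ (minTmul (α a) (β b)) := by
  have hA : Function.Injective (universalRep A) := universalRep_injective
  have hB : Function.Injective (universalRep B) := universalRep_injective
  exact (exists_state_minTensor α β φ hA hB).elim fun ψ hψ =>
    ⟨ψ.restrict (MinTensor A B), fun a b => (restrict_minTensor_minTmul ψ a b).trans (hψ a b)⟩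

/-- A state on `A ⊗_min B` is the restriction of a state on `C ⊗_min D` for every pair of embeddings
`A → C`, `B → D`. -/
lemma exists_state_minTensor_of_injective {C D : Type*} [CStarAlgebra C] [CStarAlgebra D]
    (φ : State (MinTensor A B)) {α : A →⋆ₐ[ℂ] C} {β : B →⋆ₐ[ℂ] D} (hα : Function.Injective α)
    (hβ : Function.Injective β) :
    ∃ ψ : State (MinTensor C D), ∀ a b, ψ (minTmul (α a) (β b)) = φ (minTmul a b) := by
  -- Through `α` and `β`, the universal representations of `C` and `D` are faithful on `A` and `B`,
  -- so the norm they induce dominates `φ`.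
  have hα' : Function.Injective ((universalRep C).comp α) := universalRep_injective.comp hα
  have hβ' : Function.Injective ((universalRep D).comp β) := universalRep_injective.comp hβ
  exact (exists_state_minTensor (StarAlgHom.id ℂ A) (StarAlgHom.id ℂ B) φ hα' hβ').elim
    fun ψ hψ => ⟨ψ.restrict (MinTensor C D), fun a b =>
      (restrict_minTensor_minTmul ψ (α a) (β b)).trans (hψ a b)⟩

lemma exists_injective_rep_lift {H : Type w'} [NormedAddCommGroup H] [InnerProductSpace ℂ H]
    [CompleteSpace H] {π : A →⋆ₐ[ℂ] (H →L[ℂ] H)} (hπ : Function.Injective π) :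
    ∃ (L : Type (max w w')) (_ : NormedAddCommGroup L) (_ : InnerProductSpace ℂ L)
      (_ : CompleteSpace L) (ρ : A →⋆ₐ[ℂ] (L →L[ℂ] L)), Function.Injective ρ :=
  ⟨HilbertLift.{w} H, _, _, inferInstance, liftRep.{w} π, liftRep_injective hπ⟩

/-- A C*-algebra has a faithful representation on a Hilbert space in any larger universe. -/
lemma exists_injective_rep (A : Type) [CStarAlgebra A] :
    ∃ (L : Type w) (_ : NormedAddCommGroup L) (_ : InnerProductSpace ℂ L) (_ : CompleteSpace L)
      (ρ : A →⋆ₐ[ℂ] (L →L[ℂ] L)), Function.Injective ρ :=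
  -- For `A : Type` the universal space is again in `Type`, so its copy can be placed in every
  -- universe `w`.
  exists_injective_rep_lift.{w, 0} (universalRep_injective (C := A))

end StateTransfer

lemma map_mem_unitary_matrix {n : ℕ} {C D : Type*} [CStarAlgebra C] [CStarAlgebra D]
    {U : Matrix (Fin n) (Fin n) C} (hU : U ∈ unitary (Matrix (Fin n) (Fin n) C)) (f : C →⋆ₐ[ℂ] D) :
    U.map f ∈ unitary (Matrix (Fin n) (Fin n) D) := by
  rw [Unitary.mem_iff]
  constructor
  · ext k l
    simp only [Matrix.mul_apply, Matrix.one_apply, Matrix.star_apply, Matrix.map_apply,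
      ← map_star, ← map_mul, ← map_sum, unitary_matrix_star_mul hU, apply_ite f, map_one, map_zero]
  · ext k l
    simp only [Matrix.mul_apply, Matrix.one_apply, Matrix.star_apply, Matrix.map_apply,
      ← map_star, ← map_mul, ← map_sum, unitary_matrix_mul_star hU, apply_ite f, map_one, map_zero]

/-! ### The implications, all passing through the Brown algebra. -/

section Implications

variable {n : ℕ} {Λ : State (Mat n ⊗[ℂ] Mat n) → State (Mat n ⊗[ℂ] Mat n)}

/-- A channel formula only depends on the values of the state at the products `u_{ij} u_{lk}^*` and
`v_{pr} v_{ts}^*`. -/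
lemma ChannelFormula.congr {A B A' B' : Type*} [CStarAlgebra A] [CStarAlgebra B] [CStarAlgebra A']
    [CStarAlgebra B'] {u : Matrix (Fin n) (Fin n) A} {v : Matrix (Fin n) (Fin n) B}
    {φ : State (MinTensor A B)} {u' : Matrix (Fin n) (Fin n) A'} {v' : Matrix (Fin n) (Fin n) B'}
    {φ' : State (MinTensor A' B')} (h : ChannelFormula Λ u v φ)
    (hφ : ∀ i j k l p r s t, φ' (minTmul (u' i j * star (u' l k)) (v' p r * star (v' t s))) =
      φ (minTmul (u i j * star (u l k)) (v p r * star (v t s)))) : ChannelFormula Λ u' v' φ' := by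
  intro ω g h'
  simp only [hφ]
  exact h ω g h'

lemma ChannelFormula.exists_brown {A B : Type*} [CStarAlgebra A] [CStarAlgebra B]
    {U : Matrix (Fin n) (Fin n) A} {V : Matrix (Fin n) (Fin n) B} {φ : State (MinTensor A B)}
    (hU : U ∈ unitary (Matrix (Fin n) (Fin n) A)) (hV : V ∈ unitary (Matrix (Fin n) (Fin n) B))
    (h : ChannelFormula Λ U V φ) :
    ∃ φ : State (MinTensor (BrownAlgebra n) (BrownAlgebra n)),
      ChannelFormula Λ brownGen brownGen φ := by
  obtain ⟨ψ, hψ⟩ := exists_state_minTensor_of_hom (brownLift hU) (brownLift hV) φ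
  refine ⟨ψ, h.congr fun i j k l p r s t => ?_⟩
  rw [hψ]
  simp only [map_mul, map_star, brownLift_brownGen]

/-- Realization of a channel formula by a pair of injective homomorphisms. -/
lemma ChannelFormula.exists_of_injective {A B C D : Type*} [CStarAlgebra A] [CStarAlgebra B]
    [CStarAlgebra C] [CStarAlgebra D] {u : Matrix (Fin n) (Fin n) A} {v : Matrix (Fin n) (Fin n) B}
    {φ : State (MinTensor A B)} (h : ChannelFormula Λ u v φ) {α : A →⋆ₐ[ℂ] C} {β : B →⋆ₐ[ℂ] D}
    (hα : Function.Injective α) (hβ : Function.Injective β) :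
    ∃ ψ : State (MinTensor C D), ChannelFormula Λ (u.map α) (v.map β) ψ := by
  obtain ⟨ψ, hψ⟩ := exists_state_minTensor_of_injective φ hα hβ
  refine ⟨ψ, h.congr fun i j k l p r s t => ?_⟩
  simp only [Matrix.map_apply, ← map_star, ← map_mul, hψ]

/-- `U` and `V` are representations of the Brown algebra, not necessarily faithful, and the given
state is pulled back along them. -/
lemma IsTensorUnitaryInduced.exists_brown (h : IsTensorUnitaryInduced.{u} Λ) :
    ∃ φ : State (MinTensor (BrownAlgebra n) (BrownAlgebra n)),
      ChannelFormula Λ brownGen brownGen φ := by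
  obtain ⟨HA, HB, _, _, _, _, _, _, φ, U, V, hU, hV, h⟩ := h
  obtain ⟨ψ, hψ⟩ := exists_state_minTensor_of_rep (brownLift hU) (brownLift hV) φ
  refine ⟨ψ, fun ω g h' => ?_⟩
  rw [h, productFunctional_conj]
  simp only [hψ, map_mul, map_star, brownLift_brownGen]

/-- Here faithfulness of `π` and `σ` is essential: it lets the state extend to all bounded operators
on `HA ⊗ HB`. -/
lemma ChannelFormula.isTensorUnitaryInduced {A B : Type*} [CStarAlgebra A] [CStarAlgebra B]
    {U : Matrix (Fin n) (Fin n) A} {V : Matrix (Fin n) (Fin n) B} {φ : State (MinTensor A B)}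
    (hU : U ∈ unitary (Matrix (Fin n) (Fin n) A)) (hV : V ∈ unitary (Matrix (Fin n) (Fin n) B))
    (h : ChannelFormula Λ U V φ) {HA HB : Type u} [NormedAddCommGroup HA] [InnerProductSpace ℂ HA]
    [CompleteSpace HA] [NormedAddCommGroup HB] [InnerProductSpace ℂ HB] [CompleteSpace HB]
    {π : A →⋆ₐ[ℂ] (HA →L[ℂ] HA)} {σ : B →⋆ₐ[ℂ] (HB →L[ℂ] HB)} (hπ : Function.Injective π)
    (hσ : Function.Injective σ) : IsTensorUnitaryInduced.{u} Λ := by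
  refine (exists_state_minTensor (StarAlgHom.id ℂ A) (StarAlgHom.id ℂ B) φ hπ hσ).elim
    fun ψ hψ => ?_
  refine ⟨HA, HB, _, _, inferInstance, _, _, inferInstance, ψ, U.map π, V.map σ,
    map_mem_unitary_matrix hU π, map_mem_unitary_matrix hV σ, fun ω g h' => ?_⟩
  rw [productFunctional_conj, h]
  simp only [Matrix.map_apply, ← map_star, ← map_mul, hψ, StarAlgHom.coe_id, id_eq]

/-- Pairs of unitary matrices are realized in any pair of larger algebras. -/
lemma ChannelFormula.exists_unitary_of_injective {A B : Type*} {C D : Type v} [CStarAlgebra A]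
    [CStarAlgebra B] [CStarAlgebra C] [CStarAlgebra D] {u : Matrix (Fin n) (Fin n) A}
    {v : Matrix (Fin n) (Fin n) B} (hu : u ∈ unitary (Matrix (Fin n) (Fin n) A))
    (hv : v ∈ unitary (Matrix (Fin n) (Fin n) B)) {φ : State (MinTensor A B)}
    (h : ChannelFormula Λ u v φ) {α : A →⋆ₐ[ℂ] C} {β : B →⋆ₐ[ℂ] D}
    (hα : Function.Injective α) (hβ : Function.Injective β) :
    ∃ (A B : Type v) (_ : CStarAlgebra A) (_ : CStarAlgebra B) (φ : State (MinTensor A B))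
      (U : Matrix (Fin n) (Fin n) A) (V : Matrix (Fin n) (Fin n) B),
      U ∈ unitary (Matrix (Fin n) (Fin n) A) ∧ V ∈ unitary (Matrix (Fin n) (Fin n) B) ∧
        ChannelFormula Λ U V φ :=
  (h.exists_of_injective hα hβ).elim fun ψ hψ => ⟨C, D, _, _, ψ, u.map α, v.map β,
    map_mem_unitary_matrix hu α, map_mem_unitary_matrix hv β, hψ⟩

/-- Every unitary induced channel given by the Brown algebra is given by C*-algebras in any
universe. -/
lemma exists_unitary_of_exists_brown
    (h : ∃ φ : State (MinTensor (BrownAlgebra n) (BrownAlgebra n)),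
      ChannelFormula Λ brownGen brownGen φ) :
    ∃ (A B : Type v) (_ : CStarAlgebra A) (_ : CStarAlgebra B) (φ : State (MinTensor A B))
      (U : Matrix (Fin n) (Fin n) A) (V : Matrix (Fin n) (Fin n) B),
      U ∈ unitary (Matrix (Fin n) (Fin n) A) ∧ V ∈ unitary (Matrix (Fin n) (Fin n) B) ∧
        ChannelFormula Λ U V φ := by
  -- The bounded operators on `H` serve as both C*-algebras in `Type v`.
  obtain ⟨H, _, _, _, π, hπ⟩ := exists_injective_rep.{v} (BrownAlgebra n)
  exact h.elim fun φ h =>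
    h.exists_unitary_of_injective brownGen_mem_unitary brownGen_mem_unitary hπ hπ

lemma isTensorUnitaryInduced_of_exists_brown
    (h : ∃ φ : State (MinTensor (BrownAlgebra n) (BrownAlgebra n)),
      ChannelFormula Λ brownGen brownGen φ) : IsTensorUnitaryInduced.{u} Λ := by
  obtain ⟨H, _, _, _, π, hπ⟩ := exists_injective_rep.{u} (BrownAlgebra n)
  exact h.elim fun φ h =>
    h.isTensorUnitaryInduced brownGen_mem_unitary brownGen_mem_unitary hπ hπ

lemma exists_brown_of_exists_unitary
    (h : ∃ (A B : Type v) (_ : CStarAlgebra A) (_ : CStarAlgebra B) (φ : State (MinTensor A B))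
      (U : Matrix (Fin n) (Fin n) A) (V : Matrix (Fin n) (Fin n) B),
      U ∈ unitary (Matrix (Fin n) (Fin n) A) ∧ V ∈ unitary (Matrix (Fin n) (Fin n) B) ∧
        ChannelFormula Λ U V φ) :
    ∃ φ : State (MinTensor (BrownAlgebra n) (BrownAlgebra n)),
      ChannelFormula Λ brownGen brownGen φ :=
  h.elim fun _ h => h.elim fun _ h => h.elim fun _ h => h.elim fun _ h => h.elim fun _ h =>
    h.elim fun _ h => h.elim fun _ h => h.2.2.exists_brown h.1 h.2.1

end Implications

end UnitaryInduced

end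

theorem mainTheorem4 (n : ℕ) (Λ : State (Mat n ⊗[ℂ] Mat n) → State (Mat n ⊗[ℂ] Mat n)) :
    List.TFAE
      [IsTensorUnitaryInduced.{u} Λ,
       ∃ (A B : Type v) (_ : CStarAlgebra A) (_ : CStarAlgebra B) (φ : State (MinTensor A B))
         (U : Matrix (Fin n) (Fin n) A) (V : Matrix (Fin n) (Fin n) B),
         U ∈ unitary (Matrix (Fin n) (Fin n) A) ∧ V ∈ unitary (Matrix (Fin n) (Fin n) B) ∧
           ChannelFormula Λ U V φ,
       ∃ φ : State (MinTensor (BrownAlgebra n) (BrownAlgebra n)),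
         ChannelFormula Λ brownGen brownGen φ] := by
  tfae_have 1 → 3 := IsTensorUnitaryInduced.exists_brown
  tfae_have 3 → 1 := isTensorUnitaryInduced_of_exists_brown
  tfae_have 2 → 3 := exists_brown_of_exists_unitary
  tfae_have 3 → 2 := exists_unitary_of_exists_brown
  tfae_finish
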